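/- **Setting.** An *and/or tree* is a binary plane rooted tree whose internal nodes are labelled by $\land$ or $\lor$ and whose leaves are labelled by literals $x_i$ or $\bar x_i$ ($i\ge 1$); its size is its number of leaves. Its *tree-structure* is obtained by erasing the leaf labels; $\mathcal I$ is the family of all tree-structures. Two and/or trees are *equivalent* if they have the same tree-structure, two leaves carry the same variable in one iff they do in the other, and two leaves carry the same literal in one iff they do in the other. Let $(k_n)_{n\ge1}$ be a non-decreasing sequence of nonnegative integers tending to infinity. In model $\mathtt{(G)}$, $A_n$ is the number of and/or trees of size $n$ with leaf labels in $\{x_1,\bar x_1,\dots,x_{k_n},\bar x_{k_n}\}$; in model $\mathtt{(E)}$, $A_n$ is the number of equivalence classes containing such a tree. Put $$\mathtt{Lab}_{n,m}=(2m)^n\ \text{ in }\mathtt{(G)},\qquad \mathtt{Lab}_{n,m}=2^n\sum_{p=1}^{m}{n\brace p}2^{-p}\ \text{ in }\mathtt{(E)},\qquad \mathsf{rat}_n=\frac{\mathtt{Lab}_{n-1,k_n}}{\mathtt{Lab}_{n,k_n}},$$ where ${n\brace p}$ denotes the Stirling numbers of the second kind. A *pattern* is a binary plane rooted tree with internal nodes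 labelled by $\land$ or $\lor$ and leaves labelled by $\bullet$ (*pattern leaves*) or $\boxempty$ (*place-holders*). A *pattern language* $L$ is a set of patterns, with generating function $\ell(x,y)=\sum_{d,p}L(d,p)x^dy^p$, where $L(d,p)$ is the number of patterns in $L$ with $d$ pattern leaves and $p$ place-holders. For a family $\mathcal M$ of tree-structures, $L[\mathcal M]$ is the family of trees obtained from a pattern of $L$ by replacing every place-holder by a tree of $\mathcal M$ (pattern leaves becoming leaves). $L$ is *unambiguous* if, for every $\mathcal M$, every tree of $L[\mathcal M]$ is built in this way from a unique pattern of $L$. $L$ is *sub-critical* for $\mathcal M$ if the generating function $m(z)$ of $\mathcal M$ (by size) has a square-root singularity $\tau>0$ (near $\tau$, for $z<\tau$, $m(z)=g(z)-h(z)\sqrt{1-z/\tau}$ with $g,h$ analytic at $\tau$ and $h(\tau)\neq0$) and, for some $\varepsilon>0$, $\ell$ is analytic on $\{(x,y)\in\mathbb C^2:|x|\le\tau+\varepsilon,\ |y|\le m(\tau)+\varepsilon\}$. The labelled trees of $L[\mathcal I]$ are the and/or trees whose tree-structure lies in $L[\mathcal I]$; the number of *$L$-repetitions* of such a tree is the number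 of its $L$-pattern leaves minus the number of different variables labelling its $L$-pattern leaves. **Lemma.** Let $L$ be an unambiguous pattern language, sub-critical for $\mathcal I$, and let $r$ be a fixed positive integer. In model $\mathtt{(G)}$ let $A_n^{[r]}$ (resp. $A_n^{[\ge r]}$) be the number of labelled trees of $L[\mathcal I]$ of size $n$, with leaf labels in $\{x_1,\bar x_1,\dots,x_{k_n},\bar x_{k_n}\}$, having exactly $r$ (resp. at least $r$) $L$-repetitions; in model $\mathtt{(E)}$ let $A_n^{[r]}$ (resp. $A_n^{[\ge r]}$) be the number of equivalence classes containing such a tree. Then, in both models, as $n\to\infty$, $$\frac{A_n^{[r]}}{A_n}=\mathcal O\left(\mathsf{rat}_n^{\,r}\right)\qquad\text{and}\qquad\frac{A_n^{[\ge r]}}{A_n}=\mathcal O\left(\mathsf{rat}_n^{\,r}\right).$$ -/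

import Mathlib

open Filter Topology Asymptotics

/-- The two connectives labelling the internal nodes. -/
inductive Connective where
  | and
  | or

/-- Binary plane rooted trees, internal nodes labelled by a connective and leaves labelled by
elements of `α`. -/
inductive BTree (α : Type) where
  | leaf (a : α) : BTree α
  | node (c : Connective) (l r : BTree α) : BTree α

namespace BTree

/-- Labels of the leaves, read from left to right. -/
def leaves {α : Type} : BTree α → List α
  | leaf a => [a]
  | node _ l r => leaves l ++ leaves r

/-- The size of a tree is its number of leaves. -/
def size {α : Type} (t : BTree α) : ℕ := t.leaves.length

/-- Forget the labels of the leaves (but not those of the internal nodes). -/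
def shape {α : Type} : BTree α → BTree Unit
  | leaf _ => leaf ()
  | node c l r => node c (shape l) (shape r)

end BTree

/-- A tree-structure: connectives on the internal nodes, no labels on the leaves. -/
abbrev TreeStructure := BTree Unit

/-- The family of all tree-structures. -/
def treeStructures : Set TreeStructure := Set.univ

/-- A literal `x_i` (`pos = true`) or its negation (`pos = false`).  Variables are indexed from
`0`, so that the first `k` variables are those with `var < k`. -/
structure Literal where
  var : ℕ
  pos : Bool

/-- And/or trees: the leaves are labelled by literals. -/
abbrev AndOrTree := BTree Literal

/-- All the leaf labels of the tree are literals over the first `k` variables. -/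
def AndOrTree.UsesFirst (k : ℕ) (t : AndOrTree) : Prop := ∀ a ∈ t.leaves, a.var < k

/-- Two and/or trees are equivalent if they have the same tree-structure, two leaves carry the same
variable in one iff they do in the other, and two leaves carry the same literal in one iff they do
in the other.  Leaves are addressed by their position `i`, `j` from left to right; positions
beyond the last leaf give `none` in both trees and add no constraint. -/
instance AndOrTree.equivalence : Setoid AndOrTree where
  r A B := A.shape = B.shape ∧
    (∀ i j : ℕ, (A.leaves[i]?).map Literal.var = (A.leaves[j]?).map Literal.var ↔
      (B.leaves[i]?).map Literal.var = (B.leaves[j]?).map Literal.var) ∧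
    (∀ i j : ℕ, A.leaves[i]? = A.leaves[j]? ↔ B.leaves[i]? = B.leaves[j]?)
  iseqv :=
    { refl := fun _ => ⟨rfl, fun _ _ => Iff.rfl, fun _ _ => Iff.rfl⟩
      symm := fun h => ⟨h.1.symm, fun i j => (h.2.1 i j).symm, fun i j => (h.2.2 i j).symm⟩
      trans := fun h h' => ⟨h.1.trans h'.1, fun i j => (h.2.1 i j).trans (h'.2.1 i j),
        fun i j => (h.2.2 i j).trans (h'.2.2 i j)⟩ }

/-- The two kinds of external nodes of a pattern: pattern leaves and place-holders. -/
inductive PatternLabel where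
  | bullet
  | box

/-- A pattern. -/
abbrev Pattern := BTree PatternLabel

namespace Pattern

/-- Number of pattern leaves. -/
def bullets : Pattern → ℕ
  | .leaf .bullet => 1
  | .leaf .box => 0
  | .node _ l r => bullets l + bullets r

/-- Number of place-holders. -/
def boxes : Pattern → ℕ
  | .leaf .bullet => 0
  | .leaf .box => 1
  | .node _ l r => boxes l + boxes r

/-- `PlugsInto M p t`: the tree `t` is obtained from the pattern `p` by replacing every
place-holder by a tree of the family `M` (pattern leaves become leaves). -/
inductive PlugsInto (M : Set TreeStructure) : Pattern → TreeStructure → Prop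
  | bullet : PlugsInto M (.leaf .bullet) (.leaf ())
  | box {t : TreeStructure} (ht : t ∈ M) : PlugsInto M (.leaf .box) t
  | node (c : Connective) {p q : Pattern} {s t : TreeStructure}
      (hs : PlugsInto M p s) (ht : PlugsInto M q t) : PlugsInto M (.node c p q) (.node c s t)

/-- Labels (in the tree) of the pattern leaves, from left to right, for a tree built from the
pattern. -/
def patternLeaves {α : Type} : Pattern → BTree α → List α
  | .leaf .bullet, .leaf a => [a]
  | .node _ p q, .node _ s t => patternLeaves p s ++ patternLeaves q t
  | _, _ => []

/-- Number of pattern leaves minus number of different variables labelling them, for an and/or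
tree built from the pattern. -/
def repetitions (p : Pattern) (t : AndOrTree) : ℕ :=
  (patternLeaves p t).length - ((patternLeaves p t).map Literal.var).toFinset.card

end Pattern

/-- A pattern language is a set of patterns. -/
abbrev PatternLanguage := Set Pattern

namespace PatternLanguage

/-- The family `L[M]`. -/
def plug (L : PatternLanguage) (M : Set TreeStructure) : Set TreeStructure :=
  {t | ∃ p ∈ L, Pattern.PlugsInto M p t}

/-- For every family `M`, every tree of `L[M]` is built from a unique pattern of `L`. -/
def Unambiguous (L : PatternLanguage) : Prop :=
  ∀ M : Set TreeStructure, ∀ t ∈ L.plug M, ∃! p : Pattern, p ∈ L ∧ Pattern.PlugsInto M p t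

/-- Number of patterns of `L` with `d` pattern leaves and `p` place-holders. -/
noncomputable def count (L : PatternLanguage) (d p : ℕ) : ℕ :=
  Set.ncard {q : Pattern | q ∈ L ∧ q.bullets = d ∧ q.boxes = p}

/-- The general term of the generating function `ℓ(x, y)`. -/
noncomputable def genTerm (L : PatternLanguage) (x y : ℂ) (dp : ℕ × ℕ) : ℂ :=
  (L.count dp.1 dp.2 : ℂ) * x ^ dp.1 * y ^ dp.2

/-- The generating function `ℓ(x, y)`, the sum over `d, p` of `L(d,p) x ^ d y ^ p`. -/
noncomputable def genFun (L : PatternLanguage) (xy : ℂ × ℂ) : ℂ :=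
  ∑' dp : ℕ × ℕ, L.genTerm xy.1 xy.2 dp

end PatternLanguage

/-- Number of trees of size `n` in the family `M`. -/
noncomputable def familyCount (M : Set TreeStructure) (n : ℕ) : ℕ :=
  Set.ncard {t : TreeStructure | t ∈ M ∧ t.size = n}

/-- The generating function of the family `M` at a real point. -/
noncomputable def familyGenFun (M : Set TreeStructure) (z : ℝ) : ℝ :=
  ∑' n : ℕ, (familyCount M n : ℝ) * z ^ n

/-- `τ` is a square-root singularity of the power series `∑ a n * z ^ n`: the series converges for
`z < τ` close to `τ`, and its sum is there `g z - h z * √(1 - z / τ)` with `g` and `h` analytic at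
`τ` and `h τ ≠ 0`.  (As `h τ ≠ 0`, the sum has no analytic extension to `τ`; so `τ` is the radius
of convergence if the coefficients are nonnegative.) -/
def IsSquareRootSingularity (a : ℕ → ℝ) (τ : ℝ) : Prop :=
  0 < τ ∧ ∃ g h : ℝ → ℝ, AnalyticAt ℝ g τ ∧ AnalyticAt ℝ h τ ∧ h τ ≠ 0 ∧
    ∀ᶠ z in 𝓝[<] τ, HasSum (fun n : ℕ => a n * z ^ n) (g z - h z * √(1 - z / τ))

/-- `L` is sub-critical for `M`: the generating function `m` of `M` has a square-root singularity
`τ`, and for some `ε > 0` the generating function of `L` is analytic (its series converges and the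
sum is analytic) on the set where `|x| ≤ τ + ε` and `|y| ≤ m(τ) + ε`. -/
def PatternLanguage.Subcritical (L : PatternLanguage) (M : Set TreeStructure) : Prop :=
  ∃ τ : ℝ, IsSquareRootSingularity (fun n => (familyCount M n : ℝ)) τ ∧
    ∃ ε : ℝ, 0 < ε ∧
      (∀ xy ∈ {xy : ℂ × ℂ | ‖xy.1‖ ≤ τ + ε ∧ ‖xy.2‖ ≤ familyGenFun M τ + ε},
        Summable (L.genTerm xy.1 xy.2)) ∧
      AnalyticOnNhd ℂ L.genFun
        {xy : ℂ × ℂ | ‖xy.1‖ ≤ τ + ε ∧ ‖xy.2‖ ≤ familyGenFun M τ + ε}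

/-- The and/or tree `t` is a labelled tree of `L[I]`, where `I` is the family of all
tree-structures, and it has exactly `s` `L`-repetitions.  For an unambiguous `L` the pattern `p`,
hence `s`, is determined by `t`. -/
def PatternLanguage.HasRepetitions (L : PatternLanguage) (t : AndOrTree) (s : ℕ) : Prop :=
  ∃ p ∈ L, Pattern.PlugsInto treeStructures p t.shape ∧ p.repetitions t = s

/-- The two models: uniform and/or trees (`G`), and uniform equivalence classes of and/or
trees (`E`). -/
inductive CatalanModel where
  | G
  | E

namespace CatalanModel

/-- Number of trees in `S` (model `G`), resp. of equivalence classes containing a tree of `S`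
(model `E`). -/
noncomputable def count : CatalanModel → Set AndOrTree → ℕ
  | G, S => S.ncard
  | E, S => ((fun t : AndOrTree => (⟦t⟧ : Quotient AndOrTree.equivalence)) '' S).ncard

/-- And/or trees of size `n` labelled with the first `k` variables. -/
def trees (n k : ℕ) : Set AndOrTree := {t | t.size = n ∧ AndOrTree.UsesFirst k t}

/-- `A_n`, for `k = k_n`. -/
noncomputable def total (m : CatalanModel) (n k : ℕ) : ℕ := m.count (trees n k)

/-- Number of (classes of) trees of `L[I]` with exactly `r` `L`-repetitions. -/
noncomputable def exactly (m : CatalanModel) (L : PatternLanguage) (r n k : ℕ) : ℕ :=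
  m.count {t | t ∈ trees n k ∧ L.HasRepetitions t r}

/-- Number of (classes of) trees of `L[I]` with at least `r` `L`-repetitions. -/
noncomputable def atLeast (m : CatalanModel) (L : PatternLanguage) (r n k : ℕ) : ℕ :=
  m.count {t | t ∈ trees n k ∧ ∃ s, r ≤ s ∧ L.HasRepetitions t s}

/-- The number `Lab_{n,k}` of ways to label `n` leaves with `k` variables. -/
noncomputable def lab : CatalanModel → ℕ → ℕ → ℝ
  | G, n, k => (2 * (k : ℝ)) ^ n
  | E, n, k => 2 ^ n * ∑ p ∈ Finset.Icc 1 k, (Nat.stirlingSecond n p : ℝ) * (2 ^ p)⁻¹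

/-- `rat_n = Lab_{n-1,k_n} / Lab_{n,k_n}`, for `n ≥ 1` and `k = k_n`. -/
noncomputable def rat (m : CatalanModel) (n k : ℕ) : ℝ := m.lab (n - 1) k / m.lab n k

end CatalanModel

/-!
An and/or tree is a tree-structure together with a labelling of its leaves, so both models count
pairs of a tree-structure and a class of labellings (`count_eq_ncard_treeCode`). In particular
`A_n = T_n * Lab_n`, where `T_n` is the number of tree-structures of size `n` (`total_eq`,
`wordCount_eq_lab`; in model `E` the classes of labellings are counted through canonical words).

*Labels.* Let `P` be a set of `d` leaves. A labelling with at least `r` repetitions on `P` has two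
leaves of `P` with the same variable. Removing one of them loses one repetition, and the label
removed is determined up to sign; hence by induction there are at most
`(2 d ^ 2) ^ r * Lab_{n - r}` classes of such labellings (`ncard_wordClass_repetitions_le`).
A union bound over the patterns of `L` then gives
`A_n^{[≥ r]} ≤ Lab_{n - r} * ∑ q, (2 d(q) ^ 2) ^ r * N_q(n)`, where `N_q(n)` is
the number of tree-structures of size `n` built from the pattern `q` (`atLeast_le`). For an upper
bound, a tree may be counted for several patterns.

*Structures.* The generating function `m` of tree-structures satisfies `m = z + 2 m ^ 2`. This
gives the coefficients of all its powers in closed form (`forestCount_succ_eq`), and from there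
`N_q(n) ≤ C * ρ ^ d * (b + 1) * (1 / 4) ^ b * T_n` for every `ρ > 1 / 8`, if `q` has `d` pattern
leaves and `b` place-holders (`exists_familyCount_plugsInto_le`). The same functional equation
shows that a square-root singularity of `m` can only be `1 / 8`, with `m(1 / 8) = 1 / 4`
(`eq_of_isSquareRootSingularity`); so by sub-criticality `ℓ` converges at `(1 / 8 + ε, 1 / 4 + ε)`
for some `ε > 0`, and the weighted sum over `q` is `O(T_n)`
(`exists_sum_weighted_familyCount_le`).

*Ratios.* It remains to see that `Lab_{n - r} / Lab_n = O(rat_n ^ r)` uniformly in the number of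
variables, which follows from `Lab_n * Lab_{n + 2} ≤ 5 / 2 * Lab_{n + 1} ^ 2` (`lab_mul_lab_le`).
This is an equality without the constant in model `G`. In model `E`, `Lab_{n + 1} / Lab_n` is, up
to a bounded term, twice the mean of `p` for the weights `S(n, p) 2 ^ (-p)`, `p ≤ k`, and log-concavity
of `p! S(n, p)` in `p` shows that this mean grows by at most one from `n` to `n + 1`
(`touchardMoment_succ_mul_le`).
-/

/-! ### Generating functions of families of trees -/

namespace BTree

theorem size_pos {α : Type} (t : BTree α) : 0 < t.size := by
  induction t with
  | leaf a => simp [size, leaves]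
  | node c l r hl hr => simp only [size, leaves, List.length_append] at *; omega

theorem size_node {α : Type} (c : Connective) (l r : BTree α) :
    (node c l r).size = l.size + r.size := by
  simp [size, leaves]

theorem finite_size_le (α : Type) [Finite α] (n : ℕ) : {t : BTree α | t.size ≤ n}.Finite := by
  induction n with
  | zero =>
    refine Set.finite_empty.subset fun t ht => ?_
    have := t.size_pos
    simp only [Set.mem_ofPred_eq] at ht
    omega
  | succ n ih =>
    refine ((Set.finite_range (leaf : α → BTree α)).union
      ((ih.image2 (node .and) ih).union (ih.image2 (node .or) ih))).subset ?_
    rintro (a | ⟨c, l, r⟩) ht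
    · exact Or.inl ⟨a, rfl⟩
    · have h1 := l.size_pos
      have h2 := r.size_pos
      rw [Set.mem_ofPred_eq, size_node] at ht
      right
      cases c
      · exact Or.inl ⟨l, by simp only [Set.mem_ofPred_eq]; omega, r,
          by simp only [Set.mem_ofPred_eq]; omega, rfl⟩
      · exact Or.inr ⟨l, by simp only [Set.mem_ofPred_eq]; omega, r,
          by simp only [Set.mem_ofPred_eq]; omega, rfl⟩

end BTree

/-- The trees of size `n` in a family of tree-structures form a finite set. -/
theorem finite_family (S : Set TreeStructure) (n : ℕ) : {t | t ∈ S ∧ t.size = n}.Finite :=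
  (BTree.finite_size_le Unit n).subset fun _ h => h.2.le

/-- The generating function of a family of tree-structures by size, as a formal power series. -/
noncomputable def familySeries (S : Set TreeStructure) : PowerSeries ℕ :=
  PowerSeries.mk (familyCount S)

theorem familySeries_image2_node (c : Connective) (S T : Set TreeStructure) :
    familySeries (Set.image2 (BTree.node c) S T) = familySeries S * familySeries T := by
  ext n
  rw [PowerSeries.coeff_mul]
  simp only [familySeries, PowerSeries.coeff_mk, familyCount]
  have hset : {t | t ∈ Set.image2 (BTree.node c) S T ∧ t.size = n} =
      ⋃ ij ∈ (Finset.HasAntidiagonal.antidiagonal n : Set (ℕ × ℕ)),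
        (fun p : TreeStructure × TreeStructure => BTree.node c p.1 p.2) ''
          ({t | t ∈ S ∧ t.size = ij.1} ×ˢ {t | t ∈ T ∧ t.size = ij.2}) := by
    ext t
    simp only [Set.mem_ofPred_eq, Set.mem_iUnion, Set.mem_image, Set.mem_prod, Finset.mem_coe,
      Finset.HasAntidiagonal.mem_antidiagonal]
    constructor
    · rintro ⟨⟨l, hl, r, hr, rfl⟩, hn⟩
      rw [BTree.size_node] at hn
      exact ⟨(l.size, r.size), hn, (l, r), ⟨⟨hl, rfl⟩, hr, rfl⟩, rfl⟩
    · rintro ⟨⟨i, j⟩, hij, ⟨l, r⟩, ⟨⟨hl, hi⟩, hr, hj⟩, rfl⟩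
      refine ⟨⟨l, hl, r, hr, rfl⟩, ?_⟩
      rw [BTree.size_node]
      dsimp only at hi hj hij ⊢
      omega
  rw [hset, (Finset.finite_toSet _).ncard_biUnion, finsum_mem_coe_finset]
  · refine Finset.sum_congr rfl fun ij _ => ?_
    rw [Set.ncard_image_of_injective, Set.ncard_prod]
    rintro ⟨a, b⟩ ⟨a', b'⟩ h
    simpa using h
  · exact fun ij _ => ((finite_family S _).prod (finite_family T _)).image _
  · rintro ⟨i, j⟩ - ⟨i', j'⟩ - hne
    refine Set.disjoint_left.2 ?_
    rintro _ ⟨⟨l, r⟩, ⟨⟨-, hi⟩, -, hj⟩, rfl⟩ ⟨⟨l', r'⟩, ⟨⟨-, hi'⟩, -, hj'⟩, h⟩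
    simp only [BTree.node.injEq, true_and] at h
    obtain ⟨rfl, rfl⟩ := h
    exact hne (by simp_all)

theorem familySeries_union {S T : Set TreeStructure} (h : Disjoint S T) :
    familySeries (S ∪ T) = familySeries S + familySeries T := by
  ext n
  simp only [familySeries, PowerSeries.coeff_mk, familyCount, map_add]
  rw [← Set.ncard_union_eq _ (finite_family S n) (finite_family T n)]
  · congr 1
    ext t
    simp only [Set.mem_ofPred_eq, Set.mem_union]
    tauto
  · exact Set.disjoint_left.2 fun t ht ht' => Set.disjoint_left.1 h ht.1 ht'.1

theorem familySeries_leaf : familySeries {BTree.leaf ()} = PowerSeries.X := by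
  ext n
  simp only [familySeries, PowerSeries.coeff_mk, familyCount, PowerSeries.coeff_X]
  split_ifs with h
  · rw [Set.ncard_eq_one]
    refine ⟨.leaf (), ?_⟩
    ext t
    simp only [Set.mem_singleton_iff, Set.mem_ofPred_eq, h]
    constructor
    · exact fun h => h.1
    · rintro rfl; exact ⟨rfl, rfl⟩
  · have : {t : TreeStructure | t ∈ ({BTree.leaf ()} : Set TreeStructure) ∧ t.size = n} = ∅ := by
      ext t
      simp only [Set.mem_singleton_iff, Set.mem_ofPred_eq, Set.mem_empty_iff_false, iff_false]
      rintro ⟨rfl, h'⟩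
      exact h h'.symm
    rw [this, Set.ncard_empty]

/-- A tree-structure is a leaf or one of the two connectives above two tree-structures. -/
theorem familySeries_treeStructures :
    familySeries treeStructures = PowerSeries.X + 2 * familySeries treeStructures ^ 2 := by
  have h : treeStructures = {BTree.leaf ()} ∪
      (Set.image2 (BTree.node .and) treeStructures treeStructures ∪
        Set.image2 (BTree.node .or) treeStructures treeStructures) := by
    ext t
    simp only [treeStructures, Set.mem_univ, true_iff]
    rcases t with _ | ⟨_ | _, l, r⟩
    · exact Or.inl rfl
    · exact Or.inr (Or.inl ⟨l, trivial, r, trivial, rfl⟩)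
    · exact Or.inr (Or.inr ⟨l, trivial, r, trivial, rfl⟩)
  conv_lhs => rw [h]
  rw [familySeries_union, familySeries_union, familySeries_image2_node, familySeries_image2_node,
    familySeries_leaf]
  · ring
  · refine Set.disjoint_left.2 ?_
    rintro _ ⟨l, -, r, -, rfl⟩ ⟨l', -, r', -, h⟩
    simp at h
  · refine Set.disjoint_left.2 ?_
    rintro _ rfl (⟨l', -, r', -, h⟩ | ⟨l', -, r', -, h⟩) <;> simp at h

/-- The trees built from a pattern with `d` pattern leaves and `b` place-holders have generating
function `z ^ d * m(z) ^ b`. -/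
theorem familySeries_plugsInto (q : Pattern) :
    familySeries {t | q.PlugsInto treeStructures t} =
      PowerSeries.X ^ q.bullets * familySeries treeStructures ^ q.boxes := by
  induction q with
  | leaf a =>
    cases a with
    | bullet =>
      have : {t | Pattern.PlugsInto treeStructures (.leaf .bullet) t} = {BTree.leaf ()} := by
        ext t
        simp only [Set.mem_ofPred_eq, Set.mem_singleton_iff]
        constructor
        · rintro ⟨⟩; rfl
        · rintro rfl; exact .bullet
      rw [this, familySeries_leaf]
      simp [Pattern.bullets, Pattern.boxes]
    | box =>
      have : {t | Pattern.PlugsInto treeStructures (.leaf .box) t} = treeStructures := by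
        ext t
        exact ⟨fun _ => trivial, fun h => .box h⟩
      rw [this]
      simp [Pattern.bullets, Pattern.boxes]
  | node c p q hp hq =>
    have : {t | Pattern.PlugsInto treeStructures (.node c p q) t} = Set.image2 (BTree.node c)
        {t | Pattern.PlugsInto treeStructures p t} {t | Pattern.PlugsInto treeStructures q t} := by
      ext t
      constructor
      · rintro (_ | _ | ⟨_, hs, ht⟩)
        exact ⟨_, hs, _, ht, rfl⟩
      · rintro ⟨s, hs, t, ht, rfl⟩
        exact .node c hs ht
    rw [this, familySeries_image2_node, hp, hq]
    simp only [Pattern.bullets, Pattern.boxes]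
    ring

/-! ### Powers of the generating function of tree-structures -/

/-- The coefficient of `z ^ (p + j)` in the `p`-th power of the generating function of
tree-structures. -/
noncomputable def forestCount (p j : ℕ) : ℕ :=
  PowerSeries.coeff (p + j) (familySeries treeStructures ^ p)

theorem constantCoeff_familySeries (S : Set TreeStructure) :
    PowerSeries.constantCoeff (familySeries S) = 0 := by
  rw [← PowerSeries.coeff_zero_eq_constantCoeff_apply]
  simp only [familySeries, PowerSeries.coeff_mk, familyCount]
  have : {t | t ∈ S ∧ t.size = 0} = ∅ := by
    ext t
    have := t.size_pos
    simp only [Set.mem_ofPred_eq, Set.mem_empty_iff_false, iff_false]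
    omega
  rw [this, Set.ncard_empty]

theorem X_dvd_familySeries (S : Set TreeStructure) : PowerSeries.X ∣ familySeries S :=
  PowerSeries.X_dvd_iff.2 (constantCoeff_familySeries S)

theorem coeff_familySeries_pow_of_lt (S : Set TreeStructure) {p n : ℕ} (h : n < p) :
    PowerSeries.coeff n (familySeries S ^ p) = 0 :=
  PowerSeries.X_pow_dvd_iff.1 (pow_dvd_pow_of_dvd (X_dvd_familySeries S) p) n h

theorem forestCount_zero_succ (j : ℕ) : forestCount 0 (j + 1) = 0 := by
  simp [forestCount, PowerSeries.coeff_one]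

theorem familySeries_pow_succ (p : ℕ) : familySeries treeStructures ^ (p + 1) =
    familySeries treeStructures ^ p * PowerSeries.X +
      2 * familySeries treeStructures ^ (p + 2) := by
  rw [pow_succ]
  nth_rewrite 2 [familySeries_treeStructures]
  ring

theorem forestCount_succ_succ (p j : ℕ) :
    forestCount (p + 1) (j + 1) = forestCount p (j + 1) + 2 * forestCount (p + 2) j := by
  have h2 : (2 : PowerSeries ℕ) = PowerSeries.C 2 := rfl
  rw [forestCount, familySeries_pow_succ, map_add, h2, PowerSeries.coeff_C_mul,
    show p + 1 + (j + 1) = (p + (j + 1)) + 1 by ring, PowerSeries.coeff_succ_mul_X,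
    show p + (j + 1) + 1 = p + 2 + j by ring]
  rfl

theorem forestCount_right_zero (p : ℕ) : forestCount p 0 = 1 := by
  induction p with
  | zero => simp [forestCount]
  | succ p ih =>
    have h2 : (2 : PowerSeries ℕ) = PowerSeries.C 2 := rfl
    rw [forestCount, familySeries_pow_succ, map_add, h2, PowerSeries.coeff_C_mul, add_zero,
      PowerSeries.coeff_succ_mul_X, coeff_familySeries_pow_of_lt _ (show p + 1 < p + 2 by omega)]
    simpa [forestCount] using ih

open Nat in
/-- The closed form of the coefficients of the powers of the generating function (ballot
numbers, weighted by the choices of connectives). -/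
theorem forestCount_succ_eq (p j : ℕ) :
    (forestCount (p + 1) j : ℝ) =
      2 ^ j * (p + 1) * (p + 2 * j)! / ((p + 1 + j)! * j !) := by
  induction j generalizing p with
  | zero =>
    rw [forestCount_right_zero]
    have : ((p + 1)! : ℝ) = (p + 1) * p ! := by rw [Nat.factorial_succ]; push_cast; ring
    have h : (p ! : ℝ) ≠ 0 := by positivity
    simp only [pow_zero, mul_zero, add_zero, this, Nat.factorial_zero]
    field_simp
    norm_num
  | succ j ih =>
    have hj : ((j + 1)! : ℝ) = (j + 1) * j ! := by rw [Nat.factorial_succ]; push_cast; ring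
    induction p with
    | zero =>
      rw [forestCount_succ_succ, forestCount_zero_succ]
      push_cast
      rw [ih, hj, show 0 + 1 + 1 + j = j + 2 by ring, show 0 + 1 + (j + 1) = j + 2 by ring,
        show 0 + 1 + 2 * j = 2 * j + 1 by ring, show 0 + 2 * (j + 1) = (2 * j + 1) + 1 by ring,
        Nat.factorial_succ (2 * j + 1)]
      push_cast
      field_simp
      ring
    | succ p ihp =>
      rw [forestCount_succ_succ]
      push_cast
      have h1 : ((p + 1 + 1 + (j + 1))! : ℝ) = (p + j + 3) * (p + 1 + (j + 1))! := by
        rw [show p + 1 + 1 + (j + 1) = (p + 1 + (j + 1)) + 1 by ring, Nat.factorial_succ]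
        push_cast; ring
      have h2 : ((p + 1 + 2 * (j + 1))! : ℝ) = (p + 2 * j + 3) * (p + 2 * (j + 1))! := by
        rw [show p + 1 + 2 * (j + 1) = (p + 2 * (j + 1)) + 1 by ring, Nat.factorial_succ]
        push_cast; ring
      rw [ihp, ih, show p + 1 + 1 + 1 + j = p + 1 + 1 + (j + 1) by ring,
        show p + 1 + 1 + 2 * j = p + 2 * (j + 1) by ring, h1, h2, hj]
      push_cast
      field_simp
      ring

/-! ### Numbers of tree-structures and of trees built from a pattern -/

theorem familyCount_succ_eq_forestCount (n : ℕ) :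
    familyCount treeStructures (n + 1) = forestCount 1 n := by
  simp [forestCount, familySeries, add_comm]

/-- First-order recurrence for the numbers `2 ^ (n - 1) * catalan (n - 1)` of tree-structures. -/
theorem familyCount_recurrence (n : ℕ) :
    ((n : ℝ) + 2) * familyCount treeStructures (n + 2) =
      (8 * n + 4) * familyCount treeStructures (n + 1) := by
  rw [familyCount_succ_eq_forestCount, familyCount_succ_eq_forestCount]
  have h := forestCount_succ_eq 0 n
  have h' := forestCount_succ_eq 0 (n + 1)
  rw [zero_add] at h h'
  rw [h, h', show 0 + 2 * (n + 1) = (2 * n + 1) + 1 by ring, zero_add,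
    show 1 + (n + 1) = (1 + n) + 1 by ring, Nat.factorial_succ (2 * n + 1),
    Nat.factorial_succ (2 * n), Nat.factorial_succ (1 + n), Nat.factorial_succ n]
  push_cast
  field_simp
  ring

theorem familyCount_succ_pos (n : ℕ) : 0 < familyCount treeStructures (n + 1) := by
  induction n with
  | zero => rw [familyCount_succ_eq_forestCount, forestCount_right_zero]; exact one_pos
  | succ n ih =>
    have h := familyCount_recurrence n
    have h1 : (0 : ℝ) < (8 * n + 4) * familyCount treeStructures (n + 1) := by positivity
    rw [← h] at h1
    exact_mod_cast pos_of_mul_pos_right h1 (by positivity)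

theorem familyCount_pos {n : ℕ} (hn : 0 < n) : 0 < familyCount treeStructures n := by
  obtain ⟨n, rfl⟩ := Nat.exists_eq_succ_of_ne_zero hn.ne'
  exact familyCount_succ_pos n

theorem coeff_familySeries_pow_succ_le (p N : ℕ) :
    ((PowerSeries.coeff N (familySeries treeStructures ^ (p + 2)) : ℕ) : ℝ) * (4 * (p + 1)) ≤
      (p + 2) * ((PowerSeries.coeff N (familySeries treeStructures ^ (p + 1)) : ℕ) : ℝ) := by
  rcases lt_or_ge N (p + 2) with h | h
  · rw [coeff_familySeries_pow_of_lt _ h]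
    simp only [Nat.cast_zero, zero_mul]
    positivity
  · obtain ⟨j, rfl⟩ := Nat.exists_eq_add_of_le h
    have e1 : PowerSeries.coeff (p + 2 + j) (familySeries treeStructures ^ (p + 2)) =
        forestCount (p + 2) j := rfl
    have e2 : PowerSeries.coeff (p + 2 + j) (familySeries treeStructures ^ (p + 1)) =
        forestCount (p + 1) (j + 1) := by
      rw [forestCount]; congr 2; ring
    rw [e1, e2, forestCount_succ_eq (p + 1) j, forestCount_succ_eq p (j + 1),
      show p + 1 + (j + 1) = p + 1 + 1 + j by ring,
      show p + 2 * (j + 1) = (p + 1 + 2 * j) + 1 by ring,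
      Nat.factorial_succ (p + 1 + 2 * j), Nat.factorial_succ j]
    have hD : (0 : ℝ) < ((p + 1 + 1 + j).factorial : ℝ) * (j.factorial : ℝ) := by positivity
    push_cast
    rw [div_mul_eq_mul_div, ← mul_div_assoc, div_le_div_iff₀ hD (by positivity)]
    have hA : (0 : ℝ) ≤ 2 ^ j * (p + 1) * (p + 2) * ((p + 1 + 2 * j).factorial : ℝ) *
        (((p + 1 + 1 + j).factorial : ℝ) * (j.factorial : ℝ)) * (2 * p) := by positivity
    rw [pow_succ]
    linarith

/-- The coefficients of the `b`-th power of the generating function `m` of tree-structures are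
dominated by those of `b * m(1/8) ^ (b - 1) * m`, where `m(1/8) = 1/4`. -/
theorem coeff_familySeries_pow_le (b N : ℕ) :
    ((PowerSeries.coeff N (familySeries treeStructures ^ (b + 1)) : ℕ) : ℝ) ≤
      (b + 1) * (1 / 4) ^ b * familyCount treeStructures N := by
  induction b with
  | zero => simp [familySeries]
  | succ b ih =>
    have h := coeff_familySeries_pow_succ_le b N
    have hb : (0 : ℝ) < 4 * (b + 1) := by positivity
    rw [← le_div_iff₀ hb] at h
    refine h.trans ?_
    rw [div_le_iff₀ hb]
    calc _ ≤ ((b : ℝ) + 2) * ((b + 1) * (1 / 4) ^ b * familyCount treeStructures N) := by gcongr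
      _ = _ := by push_cast; ring

/-- The numbers of tree-structures grow like `8 ^ n` up to sub-exponential factors. -/
theorem exists_familyCount_le {ρ : ℝ} (hρ : 1 / 8 < ρ) :
    ∃ C : ℝ, 0 < C ∧ ∀ n d : ℕ, (familyCount treeStructures (n + 1) : ℝ) ≤
      C * ρ ^ d * familyCount treeStructures (n + 1 + d) := by
  have hρ0 : 0 < ρ := by linarith
  set K : ℝ := max 1 ρ⁻¹ with hK
  have hK1 : 1 ≤ K := le_max_left _ _
  have hKρ : 1 ≤ K * ρ := by
    rw [← inv_mul_cancel₀ hρ0.ne']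
    gcongr
    exact le_max_right _ _
  obtain ⟨N, hN⟩ := exists_nat_gt ((2 : ℝ) / (8 * ρ - 1))
  have hN' : (2 : ℝ) < (8 * ρ - 1) * N := by
    rwa [div_lt_iff₀' (by linarith)] at hN
  -- The correcting factor `K ^ min n N` makes up for the finitely many small `n` for which the
  -- ratio of consecutive terms exceeds `ρ`.
  have hmono : Monotone fun n : ℕ =>
      (familyCount treeStructures (n + 1) : ℝ) * ρ ^ n * K ^ min n N := by
    refine monotone_nat_of_le_succ fun n => ?_
    have hrec := familyCount_recurrence n
    have hT : (0 : ℝ) ≤ familyCount treeStructures (n + 1) := by positivity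
    have hn : (0 : ℝ) < n + 2 := by positivity
    rcases lt_or_ge n N with h | h
    · have hle : (familyCount treeStructures (n + 1) : ℝ) ≤ familyCount treeStructures (n + 2) := by
        have h1 : ((n : ℝ) + 2) * familyCount treeStructures (n + 1) ≤
            (n + 2) * familyCount treeStructures (n + 2) := by
          rw [hrec]; gcongr <;> linarith [(Nat.cast_nonneg n : (0 : ℝ) ≤ n)]
        exact le_of_mul_le_mul_left h1 hn
      rw [min_eq_left h.le, min_eq_left h, pow_succ, pow_succ]
      calc _ = (familyCount treeStructures (n + 1) : ℝ) * ρ ^ n * K ^ n * 1 := by ring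
        _ ≤ (familyCount treeStructures (n + 2) : ℝ) * ρ ^ n * K ^ n * (K * ρ) := by gcongr
        _ = _ := by ring
    · have hle : (familyCount treeStructures (n + 1) : ℝ) ≤
          ρ * familyCount treeStructures (n + 2) := by
        have hnN : (N : ℝ) ≤ n := by exact_mod_cast h
        have h1 : ((n : ℝ) + 2) * familyCount treeStructures (n + 1) ≤
            (n + 2) * (ρ * familyCount treeStructures (n + 2)) := by
          rw [mul_left_comm, hrec, ← mul_assoc]
          gcongr
          nlinarith
        exact le_of_mul_le_mul_left h1 hn
      rw [min_eq_right h, min_eq_right (by omega), pow_succ]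
      calc _ ≤ (ρ * familyCount treeStructures (n + 2) : ℝ) * ρ ^ n * K ^ N := by gcongr
        _ = _ := by ring
  refine ⟨K ^ N, by positivity, fun n d => ?_⟩
  have h := hmono (Nat.le_add_right n d)
  beta_reduce at h
  have h1 : (1 : ℝ) ≤ K ^ min n N := one_le_pow₀ hK1
  have h2 : K ^ min (n + d) N ≤ K ^ N := pow_le_pow_right₀ hK1 (min_le_right _ _)
  have h3 : (familyCount treeStructures (n + 1) : ℝ) * ρ ^ n ≤
      (K ^ N * ρ ^ d * familyCount treeStructures (n + 1 + d)) * ρ ^ n := by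
    calc (familyCount treeStructures (n + 1) : ℝ) * ρ ^ n
        = (familyCount treeStructures (n + 1) : ℝ) * ρ ^ n * 1 := by ring
      _ ≤ (familyCount treeStructures (n + 1) : ℝ) * ρ ^ n * K ^ min n N := by gcongr
      _ ≤ _ := h
      _ ≤ (familyCount treeStructures (n + d + 1) : ℝ) * ρ ^ (n + d) * K ^ N := by gcongr
      _ = _ := by rw [show n + d + 1 = n + 1 + d by ring]; ring
  exact le_of_mul_le_mul_right h3 (by positivity)

/-- Number of trees of size `n` built from a pattern, in terms of the numbers of its pattern leaves
and place-holders: dropping `d` leaves costs about `8 ^ (-d)`, and each place-holder contributes a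
factor `m(1/8) = 1/4`. -/
theorem exists_familyCount_plugsInto_le {ρ : ℝ} (hρ : 1 / 8 < ρ) :
    ∃ C : ℝ, 0 < C ∧ ∀ (q : Pattern) (n : ℕ), 0 < n →
      (familyCount {t | Pattern.PlugsInto treeStructures q t} n : ℝ) ≤
        C * ρ ^ q.bullets * ((q.boxes + 1) * (1 / 4) ^ q.boxes) *
          familyCount treeStructures n := by
  obtain ⟨C, hC, hle⟩ := exists_familyCount_le hρ
  have hρ0 : 0 < ρ := by linarith
  refine ⟨C * max 4 ρ⁻¹, by positivity, fun q n hn => ?_⟩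
  have hcoeff : familyCount {t | Pattern.PlugsInto treeStructures q t} n =
      PowerSeries.coeff n (familySeries {t | Pattern.PlugsInto treeStructures q t}) := by
    simp [familySeries]
  rw [hcoeff, familySeries_plugsInto, PowerSeries.coeff_X_pow_mul']
  split_ifs with hd
  swap
  · simp only [Nat.cast_zero]; positivity
  obtain ⟨e, rfl⟩ := Nat.exists_eq_add_of_le' hd
  rw [Nat.add_sub_cancel]
  rcases hb : q.boxes with _ | b
  · rw [pow_zero, PowerSeries.coeff_one]
    split_ifs with he
    swap
    · simp only [Nat.cast_zero]; positivity
    subst he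
    rw [zero_add] at hn ⊢
    obtain ⟨d, hd⟩ := Nat.exists_eq_succ_of_ne_zero hn.ne'
    have h := hle 0 d
    rw [familyCount_succ_eq_forestCount, forestCount_right_zero] at h
    rw [hd, Nat.succ_eq_add_one]
    rw [show 0 + 1 + d = d + 1 by ring] at h
    calc ((1 : ℕ) : ℝ) ≤ C * ρ ^ d * familyCount treeStructures (d + 1) := h
      _ = C * ρ⁻¹ * ρ ^ (d + 1) * familyCount treeStructures (d + 1) := by
        rw [pow_succ]; field_simp
      _ ≤ C * max 4 ρ⁻¹ * ρ ^ (d + 1) * familyCount treeStructures (d + 1) := by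
        gcongr; exact le_max_right _ _
      _ = _ := by simp
  · rcases e with _ | e
    · rw [coeff_familySeries_pow_of_lt _ (by omega)]
      simp only [Nat.cast_zero]; positivity
    have hmain := calc
      ((PowerSeries.coeff (e + 1) (familySeries treeStructures ^ (b + 1)) : ℕ) : ℝ) ≤
          ((b : ℝ) + 1) * (1 / 4) ^ b * familyCount treeStructures (e + 1) :=
          coeff_familySeries_pow_le b (e + 1)
      _ ≤ (b + 2) * (1 / 4) ^ b *
          (C * ρ ^ q.bullets * familyCount treeStructures (e + 1 + q.bullets)) := by
        gcongr
        · norm_num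
        · exact hle e _
      _ = C * 4 * ρ ^ q.bullets * (((b : ℝ) + 2) * (1 / 4) ^ (b + 1)) *
          familyCount treeStructures (e + 1 + q.bullets) := by rw [pow_succ]; ring
      _ ≤ C * max 4 ρ⁻¹ * ρ ^ q.bullets * (((b : ℝ) + 2) * (1 / 4) ^ (b + 1)) *
          familyCount treeStructures (e + 1 + q.bullets) := by
        gcongr; exact le_max_left _ _
    refine hmain.trans (le_of_eq ?_)
    push_cast
    ring

/-! ### The singularity of the generating function of tree-structures -/

/-- The functional equation `m = z + 2 m ^ 2`, at every real point of convergence. -/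
theorem hasSum_familyCount_functional_equation {z s : ℝ}
    (h : HasSum (fun n : ℕ => (familyCount treeStructures n : ℝ) * z ^ n) s) :
    s = z + 2 * s ^ 2 := by
  have hs := h.summable.norm
  have hprod := summable_norm_sum_mul_antidiagonal_of_summable_norm hs hs
  have h2 : HasSum (fun n : ℕ => ∑ kl ∈ Finset.HasAntidiagonal.antidiagonal n,
      (familyCount treeStructures kl.1 : ℝ) * z ^ kl.1 *
        ((familyCount treeStructures kl.2 : ℝ) * z ^ kl.2)) (s ^ 2) := by
    have := tsum_mul_tsum_eq_tsum_sum_antidiagonal_of_summable_norm hs hs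
    rw [h.tsum_eq, ← sq] at this
    rw [this]
    exact hprod.of_norm.hasSum
  have h1 : HasSum (fun n : ℕ => if n = 1 then z else 0) z := hasSum_ite_eq 1 z
  have h3 := h1.add (h2.mul_left 2)
  refine h.unique (h3.congr_fun fun n => ?_)
  have hc := congrArg (PowerSeries.coeff n) familySeries_treeStructures
  have hC : (2 : PowerSeries ℕ) = PowerSeries.C 2 := rfl
  rw [map_add, hC, PowerSeries.coeff_C_mul, sq, PowerSeries.coeff_mul, PowerSeries.coeff_X] at hc
  simp only [familySeries, PowerSeries.coeff_mk] at hc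
  rw [hc]
  push_cast
  rw [add_mul, mul_assoc, Finset.sum_mul]
  congr 1
  · split_ifs with h <;> simp [h]
  · congr 1
    refine Finset.sum_congr rfl fun kl hkl => ?_
    rw [← Finset.HasAntidiagonal.mem_antidiagonal.1 hkl, pow_add]
    ring

/-- The only square-root singularity of the generating function of tree-structures is `1 / 8`, and
the function has the limit `1 / 4` there. -/
theorem eq_of_isSquareRootSingularity {τ : ℝ} {g h : ℝ → ℝ} (hτ : 0 < τ)
    (hg : AnalyticAt ℝ g τ) (hh : AnalyticAt ℝ h τ) (h0 : h τ ≠ 0)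
    (hsum : ∀ᶠ z in 𝓝[<] τ, HasSum (fun n : ℕ => (familyCount treeStructures n : ℝ) * z ^ n)
      (g z - h z * √(1 - z / τ))) :
    τ = 1 / 8 ∧ g τ = 1 / 4 := by
  have hle : 𝓝[<] τ ≤ 𝓝 τ := nhdsWithin_le_nhds
  have hu : Tendsto (fun z => √(1 - z / τ)) (𝓝[<] τ) (𝓝 0) := by
    have : ContinuousAt (fun z => √(1 - z / τ)) τ := by fun_prop
    have h' := this.tendsto
    rw [div_self hτ.ne', sub_self, Real.sqrt_zero] at h'
    exact h'.mono_left hle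
  have hgt : Tendsto g (𝓝[<] τ) (𝓝 (g τ)) := hg.continuousAt.tendsto.mono_left hle
  have hht : Tendsto h (𝓝[<] τ) (𝓝 (h τ)) := hh.continuousAt.tendsto.mono_left hle
  -- `(4 m - 1) ^ 2 = 1 - 8 z`, with `m = g - h u` and `u = √(1 - z / τ)`.
  have heq : ∀ᶠ z in 𝓝[<] τ, (4 * (g z - h z * √(1 - z / τ)) - 1) ^ 2 = 1 - 8 * z := by
    filter_upwards [hsum] with z hz
    linear_combination -8 * hasSum_familyCount_functional_equation hz
  have hlim : (4 * g τ - 1) ^ 2 = 1 - 8 * τ := by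
    have h1 : Tendsto (fun z => (4 * (g z - h z * √(1 - z / τ)) - 1) ^ 2) (𝓝[<] τ)
        (𝓝 ((4 * (g τ - h τ * 0) - 1) ^ 2)) :=
      (((hgt.sub (hht.mul hu)).const_mul 4).sub_const 1).pow 2
    have h2 : Tendsto (fun z => 1 - 8 * z) (𝓝[<] τ) (𝓝 (1 - 8 * τ)) :=
      ((tendsto_id.mono_left hle).const_mul 8).const_sub 1
    have := tendsto_nhds_unique (h1.congr' heq) h2
    simpa using this
  -- The part of the equation that is odd in `u` is `8 (4 g - 1) h u`, and the even part vanishes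
  -- to order `u ^ 2`; so `4 g - 1` vanishes at `τ`.
  let D : ℝ → ℝ := fun z => (4 * g z - 1) ^ 2 - (1 - 8 * z)
  have hD : DifferentiableAt ℝ D τ := by
    have := hg.differentiableAt
    fun_prop
  have hDτ : D τ = 0 := by simp only [D]; linarith
  have hslope : Tendsto (slope D τ) (𝓝[<] τ) (𝓝 (deriv D τ)) :=
    (hasDerivAt_iff_tendsto_slope.1 hD.hasDerivAt).mono_left
      (nhdsWithin_mono _ fun z hz => ne_of_lt hz)
  have hodd : ∀ᶠ z in 𝓝[<] τ, 16 * h z ^ 2 * √(1 - z / τ) - τ * √(1 - z / τ) * slope D τ z =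
      8 * (4 * g z - 1) * h z := by
    filter_upwards [heq, self_mem_nhdsWithin] with z hz hzτ
    have hzτ : z < τ := hzτ
    have hpos : 0 < 1 - z / τ := by rw [sub_pos, div_lt_one hτ]; exact hzτ
    have hu0 : 0 < √(1 - z / τ) := Real.sqrt_pos.2 hpos
    have hu2 : √(1 - z / τ) ^ 2 = 1 - z / τ := Real.sq_sqrt hpos.le
    have hzu : z - τ = -τ * √(1 - z / τ) ^ 2 := by rw [hu2]; field_simp; ring
    have hDz : D z = (z - τ) * slope D τ z := by
      rw [slope_def_field, hDτ, sub_zero, mul_div_cancel₀ _ (sub_ne_zero.2 hzτ.ne)]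
    have hDz' : D z = (4 * g z - 1) ^ 2 - (1 - 8 * z) := rfl
    refine mul_right_cancel₀ hu0.ne' ?_
    rw [hzu] at hDz
    linear_combination hz + hDz' - hDz
  have hzero : 8 * (4 * g τ - 1) * h τ = 0 := by
    have h1 := ((hgt.const_mul 4).sub_const 1 |>.const_mul 8).mul hht
    have h2 := (((hht.pow 2).const_mul 16).mul hu).sub ((hu.const_mul τ).mul hslope)
    have := tendsto_nhds_unique h1 (h2.congr' hodd)
    simpa using this
  have hg4 : 4 * g τ - 1 = 0 := by simpa [h0] using hzero
  refine ⟨?_, by linarith⟩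
  rw [hg4] at hlim
  linarith

/-- The generating function of tree-structures converges at its singularity. The default value `0`
of a divergent sum would not satisfy this bound. -/
theorem one_fourth_le_familyGenFun {l : ℝ → ℝ} (hl : Tendsto l (𝓝[<] (1 / 8)) (𝓝 (1 / 4)))
    (hsum : ∀ᶠ z in 𝓝[<] (1 / 8 : ℝ),
      HasSum (fun n : ℕ => (familyCount treeStructures n : ℝ) * z ^ n) (l z)) :
    1 / 4 ≤ familyGenFun treeStructures (1 / 8) := by
  have hpos : ∀ᶠ z in 𝓝[<] (1 / 8 : ℝ), 0 < z ∧ z < 1 / 8 := by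
    filter_upwards [Ioo_mem_nhdsLT (show (0 : ℝ) < 1 / 8 by norm_num)] with z hz using hz
  have hS : Summable fun n : ℕ => (familyCount treeStructures n : ℝ) * (1 / 8) ^ n := by
    refine summable_of_sum_range_le (c := 1 / 4) (fun n => by positivity) fun N => ?_
    have hc : Tendsto (fun z : ℝ => ∑ n ∈ Finset.range N,
        (familyCount treeStructures n : ℝ) * z ^ n) (𝓝[<] (1 / 8))
        (𝓝 (∑ n ∈ Finset.range N, (familyCount treeStructures n : ℝ) * (1 / 8) ^ n)) :=
      (Continuous.tendsto (by fun_prop) _).mono_left nhdsWithin_le_nhds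
    refine le_of_tendsto_of_tendsto hc hl ?_
    filter_upwards [hsum, hpos] with z hz h0
    exact sum_le_hasSum _ (fun n _ => by have := h0.1; positivity) hz
  refine le_of_tendsto hl ?_
  filter_upwards [hsum, hpos] with z hz h0
  refine hasSum_le (fun n => ?_) hz hS.hasSum
  have := h0.1
  have := h0.2.le
  gcongr

/-- What sub-criticality gives: the generating function of the language converges beyond the
point `(1 / 8, 1 / 4)`. -/
theorem PatternLanguage.Subcritical.exists_summable {L : PatternLanguage}
    (h : L.Subcritical treeStructures) : ∃ ε : ℝ, 0 < ε ∧ Summable fun dp : ℕ × ℕ =>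
      (L.count dp.1 dp.2 : ℝ) * (1 / 8 + ε) ^ dp.1 * (1 / 4 + ε) ^ dp.2 := by
  obtain ⟨τ, ⟨hτ, g, h, hg, hh, h0, hsum⟩, ε, hε, hS, -⟩ := h
  obtain ⟨hτ8, hg4⟩ := eq_of_isSquareRootSingularity hτ hg hh h0 hsum
  subst hτ8
  have hle : 𝓝[<] (1 / 8 : ℝ) ≤ 𝓝 (1 / 8) := nhdsWithin_le_nhds
  have hl : Tendsto (fun z => g z - h z * √(1 - z / (1 / 8))) (𝓝[<] (1 / 8)) (𝓝 (1 / 4)) := by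
    have hu : ContinuousAt (fun z : ℝ => √(1 - z / (1 / 8))) (1 / 8) := by fun_prop
    have := (hg.continuousAt.sub (hh.continuousAt.mul hu)).tendsto
    simp only [Pi.sub_apply, Pi.mul_apply, hg4] at this
    norm_num at this
    refine Tendsto.congr (fun z => ?_) (this.mono_left (by norm_num; exact hle))
    norm_num
  have hm := one_fourth_le_familyGenFun hl hsum
  refine ⟨ε, hε, ?_⟩
  have h' := (hS (((1 / 8 + ε : ℝ) : ℂ), ((1 / 4 + ε : ℝ) : ℂ)) ?_).norm
  · refine h'.congr fun dp => ?_
    rw [PatternLanguage.genTerm, norm_mul, norm_mul, norm_pow, norm_pow, Complex.norm_natCast,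
      Complex.norm_of_nonneg (by positivity), Complex.norm_of_nonneg (by positivity)]
  · simp only [Set.mem_ofPred_eq]
    rw [Complex.norm_of_nonneg (by positivity), Complex.norm_of_nonneg (by positivity)]
    exact ⟨le_rfl, by linarith⟩

/-! ### Patterns of a sub-critical language, weighted by a power of their number of leaves -/

namespace Pattern

theorem size_eq (q : Pattern) : q.size = bullets q + boxes q := by
  induction q with
  | leaf a => cases a <;> rfl
  | node c p q hp hq =>
    rw [BTree.size_node, hp, hq]
    simp only [bullets, boxes]
    ring

theorem PlugsInto.size_le {M : Set TreeStructure} {q : Pattern} {t : TreeStructure}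
    (h : PlugsInto M q t) : q.size ≤ t.size := by
  induction h with
  | bullet => exact le_rfl
  | box ht => exact BTree.size_pos _
  | node c hs ht ihs iht => rw [BTree.size_node, BTree.size_node]; omega

end Pattern

instance : Finite PatternLabel :=
  Finite.of_injective (fun a : PatternLabel => (match a with | .bullet => true | .box => false))
    (by rintro (_ | _) (_ | _) h <;> simp_all)

theorem finite_patterns (L : PatternLanguage) (n : ℕ) : {q : Pattern | q ∈ L ∧ q.size ≤ n}.Finite :=
  (BTree.finite_size_le PatternLabel n).subset fun _ h => h.2

/-- The patterns of `L` with at most `n` external nodes. -/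
noncomputable def patternsLE (L : PatternLanguage) (n : ℕ) : Finset Pattern :=
  (finite_patterns L n).toFinset

theorem mem_patternsLE {L : PatternLanguage} {n : ℕ} {q : Pattern} :
    q ∈ patternsLE L n ↔ q ∈ L ∧ q.size ≤ n := by
  simp [patternsLE]

theorem sum_patternsLE_le_tsum (L : PatternLanguage) {x y : ℝ} (hx : 0 ≤ x) (hy : 0 ≤ y)
    (h : Summable fun dp : ℕ × ℕ => (L.count dp.1 dp.2 : ℝ) * x ^ dp.1 * y ^ dp.2) (n : ℕ) :
    ∑ q ∈ patternsLE L n, x ^ Pattern.bullets q * y ^ Pattern.boxes q ≤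
      ∑' dp : ℕ × ℕ, (L.count dp.1 dp.2 : ℝ) * x ^ dp.1 * y ^ dp.2 := by
  classical
  refine le_trans ?_ (h.sum_le_tsum
    ((patternsLE L n).image fun q => (Pattern.bullets q, Pattern.boxes q))
    (fun _ _ => by positivity))
  rw [← Finset.sum_fiberwise_of_maps_to (s := patternsLE L n)
    (g := fun q : Pattern => (Pattern.bullets q, Pattern.boxes q))
    (fun q hq => Finset.mem_image_of_mem _ hq)]
  refine Finset.sum_le_sum fun dp _ => ?_
  have hconst : ∀ q ∈ (patternsLE L n).filter
      (fun q => (Pattern.bullets q, Pattern.boxes q) = dp),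
      x ^ Pattern.bullets q * y ^ Pattern.boxes q = x ^ dp.1 * y ^ dp.2 := by
    intro q hq
    rw [← (Finset.mem_filter.1 hq).2]
  rw [Finset.sum_congr rfl hconst, Finset.sum_const, nsmul_eq_mul, mul_assoc]
  refine mul_le_mul_of_nonneg_right ?_ (by positivity)
  rw [Nat.cast_le, PatternLanguage.count, ← Set.ncard_coe_finset]
  refine Set.ncard_le_ncard (fun q hq => ?_)
    ((finite_patterns L (dp.1 + dp.2)).subset fun q hq => ⟨hq.1, ?_⟩)
  · obtain ⟨h1, h2⟩ := Finset.mem_filter.1 hq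
    rw [← h2]
    exact ⟨(mem_patternsLE.1 h1).1, rfl, rfl⟩
  · rw [Pattern.size_eq]
    exact (congrArg₂ (· + ·) hq.2.1 hq.2.2).le

/-- The trees of size `n` of `L[I]`, counted with a polynomial weight in the number of pattern
leaves, are `O(T_n)`, where `T_n` is the number of tree-structures of size `n`. -/
theorem exists_sum_weighted_familyCount_le {L : PatternLanguage}
    (h : L.Subcritical treeStructures) (r : ℕ) : ∃ K : ℝ, ∀ n : ℕ, 0 < n →
      ∑ q ∈ patternsLE L n, (2 * (Pattern.bullets q : ℝ) ^ 2) ^ r *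
          (familyCount {t | Pattern.PlugsInto treeStructures q t} n : ℝ) ≤
        K * familyCount treeStructures n := by
  obtain ⟨ε, hε, hS⟩ := h.exists_summable
  obtain ⟨C, hC, hle⟩ :=
    exists_familyCount_plugsInto_le (show (1 / 8 : ℝ) < 1 / 8 + ε / 2 by linarith)
  have hratio1 : (1 / 8 + ε / 2) / (1 / 8 + ε) < 1 := by
    rw [div_lt_one (by positivity)]; linarith
  have hratio2 : (1 / 4) / (1 / 4 + ε) < 1 := by
    rw [div_lt_one (by positivity)]; linarith
  -- The polynomial factors are absorbed by slightly enlarging the bases of the powers.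
  obtain ⟨A, hA⟩ := (tendsto_pow_const_mul_const_pow_of_lt_one (2 * r)
    (by positivity) hratio1).bddAbove_range
  obtain ⟨B, hB⟩ := (tendsto_pow_const_mul_const_pow_of_lt_one 1
    (by positivity) hratio2).bddAbove_range
  have hA' : ∀ d : ℕ, (d : ℝ) ^ (2 * r) * (1 / 8 + ε / 2) ^ d ≤ A * (1 / 8 + ε) ^ d := by
    intro d
    have : (d : ℝ) ^ (2 * r) * ((1 / 8 + ε / 2) / (1 / 8 + ε)) ^ d ≤ A := hA ⟨d, rfl⟩
    rwa [div_pow, ← mul_div_assoc, div_le_iff₀ (by positivity)] at this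
  have hB' : ∀ b : ℕ, ((b : ℝ) + 1) * (1 / 4) ^ b ≤ (B + 1) * (1 / 4 + ε) ^ b := by
    intro b
    have : (b : ℝ) ^ 1 * ((1 / 4) / (1 / 4 + ε)) ^ b ≤ B := hB ⟨b, rfl⟩
    rw [div_pow, ← mul_div_assoc, div_le_iff₀ (by positivity), pow_one] at this
    have h1 : (1 / 4 : ℝ) ^ b ≤ (1 / 4 + ε) ^ b := by gcongr; linarith
    linarith
  have hA0 : 0 ≤ A := by
    have := hA' 0
    simp only [pow_zero, mul_one] at this
    exact le_trans (by positivity) this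
  have hB0 : 0 ≤ B + 1 := by
    have := hB' 0
    simp only [pow_zero, mul_one] at this
    exact le_trans (by positivity) this
  refine ⟨2 ^ r * C * A * (B + 1) *
    ∑' dp : ℕ × ℕ, (L.count dp.1 dp.2 : ℝ) * (1 / 8 + ε) ^ dp.1 * (1 / 4 + ε) ^ dp.2,
    fun n hn => ?_⟩
  have hterm : ∀ q ∈ patternsLE L n, (2 * (Pattern.bullets q : ℝ) ^ 2) ^ r *
      (familyCount {t | Pattern.PlugsInto treeStructures q t} n : ℝ) ≤
      2 ^ r * C * A * (B + 1) * familyCount treeStructures n *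
        ((1 / 8 + ε) ^ Pattern.bullets q * (1 / 4 + ε) ^ Pattern.boxes q) := by
    intro q _
    calc (2 * (Pattern.bullets q : ℝ) ^ 2) ^ r *
          (familyCount {t | Pattern.PlugsInto treeStructures q t} n : ℝ)
        ≤ (2 ^ r * (Pattern.bullets q : ℝ) ^ (2 * r)) *
          (C * (1 / 8 + ε / 2) ^ Pattern.bullets q *
            ((Pattern.boxes q + 1) * (1 / 4) ^ Pattern.boxes q) *
          familyCount treeStructures n) := by
          refine mul_le_mul ?_ (hle q n hn) (by positivity) (by positivity)
          rw [mul_pow, ← pow_mul]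
      _ = 2 ^ r * C * ((Pattern.bullets q : ℝ) ^ (2 * r) * (1 / 8 + ε / 2) ^ Pattern.bullets q) *
          ((Pattern.boxes q + 1) * (1 / 4) ^ Pattern.boxes q) * familyCount treeStructures n := by
          ring
      _ ≤ 2 ^ r * C * (A * (1 / 8 + ε) ^ Pattern.bullets q) *
          ((B + 1) * (1 / 4 + ε) ^ Pattern.boxes q) * familyCount treeStructures n := by
          refine mul_le_mul_of_nonneg_right ?_ (by positivity)
          exact mul_le_mul (mul_le_mul_of_nonneg_left (hA' _) (by positivity)) (hB' _)
            (by positivity) (by positivity)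
      _ = _ := by ring
  refine (Finset.sum_le_sum hterm).trans ?_
  rw [← Finset.mul_sum]
  have := sum_patternsLE_le_tsum L (by positivity) (by positivity) hS n
  refine (mul_le_mul_of_nonneg_left this (by positivity)).trans (le_of_eq ?_)
  ring

/-! ### The numbers of labellings -/

/-- For fixed `n`, the numbers `p! * S(n, p)` of surjections form a log-concave sequence. -/
theorem factorial_mul_stirlingSecond_logConcave (n : ℕ) {p q : ℕ} (hpq : p ≤ q) :
    (p.factorial * n.stirlingSecond p) * ((q + 1).factorial * n.stirlingSecond (q + 1)) ≤
      ((p + 1).factorial * n.stirlingSecond (p + 1)) * (q.factorial * n.stirlingSecond q) := by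
  set A : ℕ → ℕ → ℕ := fun n p => p.factorial * n.stirlingSecond p with hA
  change A n p * A n (q + 1) ≤ A n (p + 1) * A n q
  have hrec : ∀ n p, A (n + 1) (p + 1) = (p + 1) * (A n (p + 1) + A n p) := by
    intro n p
    simp only [hA, Nat.stirlingSecond_succ_succ, Nat.factorial_succ]
    ring
  have hzero : ∀ n, A (n + 1) 0 = 0 := fun n => by simp [hA]
  induction n generalizing p q with
  | zero => simp [hA]
  | succ n ih =>
    rcases hpq.eq_or_lt with rfl | hlt
    · rw [mul_comm]
    rcases p with _ | p
    · rw [hzero, zero_mul]; exact Nat.zero_le _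
    rcases q with _ | q
    · omega
    rw [hrec, hrec, hrec, hrec]
    have hpq' : p + 1 ≤ q := by omega
    have h1 := ih (show p + 1 ≤ q + 1 by omega)
    have h2 := ih hpq'
    have h3 := ih (show p ≤ q + 1 by omega)
    have h4 := ih (show p ≤ q by omega)
    have hw : (p + 1) * (q + 1 + 1) ≤ (p + 1 + 1) * (q + 1) := by nlinarith
    calc _ = ((p + 1) * (q + 1 + 1)) *
          ((A n (p + 1) + A n p) * (A n (q + 1 + 1) + A n (q + 1))) := by ring
      _ ≤ ((p + 1 + 1) * (q + 1)) *
          ((A n (p + 1 + 1) + A n (p + 1)) * (A n (q + 1) + A n q)) := by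
        refine Nat.mul_le_mul hw ?_
        rw [add_mul, mul_add, mul_add, add_mul, mul_add, mul_add]
        omega
      _ = _ := by ring

/-- The distribution with weights proportional to `S(n + 1, p + 1)` is dominated, in the likelihood
ratio order, by the one with weights proportional to `S(n, p)`. -/
theorem stirlingSecond_mul_le (n : ℕ) {p q : ℕ} (hpq : p ≤ q) :
    (n + 1).stirlingSecond (q + 1) * n.stirlingSecond p ≤
      (n + 1).stirlingSecond (p + 1) * n.stirlingSecond q := by
  have h := factorial_mul_stirlingSecond_logConcave n hpq
  rw [Nat.factorial_succ, Nat.factorial_succ] at h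
  have h' : (q + 1) * n.stirlingSecond (q + 1) * n.stirlingSecond p ≤
      (p + 1) * n.stirlingSecond (p + 1) * n.stirlingSecond q := by
    refine Nat.le_of_mul_le_mul_left (c := p.factorial * q.factorial) ?_ (by positivity)
    linarith
  rw [Nat.stirlingSecond_succ_succ, Nat.stirlingSecond_succ_succ]
  linarith

theorem sum_Icc_one_eq_sum_range (k : ℕ) (f : ℕ → ℝ) :
    ∑ p ∈ Finset.Icc 1 k, f p = ∑ i ∈ Finset.range k, f (i + 1) := by
  induction k with
  | zero => simp
  | succ k ih => rw [Finset.sum_Icc_succ_top (by omega), ih, Finset.sum_range_succ]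

/-- The polynomial `∑ p ≤ k, S(n, p) x ^ p` at `x = 1 / 2` (without its constant term). -/
noncomputable def truncatedTouchard (n k : ℕ) : ℝ :=
  ∑ i ∈ Finset.range k, (n.stirlingSecond (i + 1) : ℝ) * (1 / 2) ^ (i + 1)

/-- The first moment of the weights of `truncatedTouchard`. -/
noncomputable def touchardMoment (n k : ℕ) : ℝ :=
  ∑ i ∈ Finset.range k, ((i : ℝ) + 1) * ((n.stirlingSecond (i + 1) : ℝ) * (1 / 2) ^ (i + 1))

theorem truncatedTouchard_le_touchardMoment (n k : ℕ) :
    truncatedTouchard n k ≤ touchardMoment n k :=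
  Finset.sum_le_sum fun i _ => le_mul_of_one_le_left (by positivity)
    (by linarith [(Nat.cast_nonneg i : (0 : ℝ) ≤ i)])

theorem truncatedTouchard_succ (n k : ℕ) : truncatedTouchard (n + 1) k = touchardMoment n k +
    1 / 2 * ∑ i ∈ Finset.range k, (n.stirlingSecond i : ℝ) * (1 / 2) ^ i := by
  rw [truncatedTouchard, touchardMoment, Finset.mul_sum, ← Finset.sum_add_distrib]
  refine Finset.sum_congr rfl fun i _ => ?_
  rw [Nat.stirlingSecond_succ_succ]
  push_cast
  ring

theorem sum_stirlingSecond_range_succ (n k : ℕ) (hn : 0 < n) (f : ℕ → ℝ) :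
    ∑ i ∈ Finset.range (k + 1), f i * ((n.stirlingSecond i : ℝ) * (1 / 2) ^ i) =
      ∑ i ∈ Finset.range k, f (i + 1) * ((n.stirlingSecond (i + 1) : ℝ) * (1 / 2) ^ (i + 1)) := by
  obtain ⟨n, rfl⟩ := Nat.exists_eq_succ_of_ne_zero hn.ne'
  rw [Finset.sum_range_succ']
  simp

theorem touchardMoment_le_succ (n k : ℕ) : touchardMoment n k ≤ truncatedTouchard (n + 1) k := by
  rw [truncatedTouchard_succ]
  have : (0 : ℝ) ≤ ∑ i ∈ Finset.range k, (n.stirlingSecond i : ℝ) * (1 / 2) ^ i :=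
    Finset.sum_nonneg fun i _ => by positivity
  linarith

theorem truncatedTouchard_succ_le (n k : ℕ) (hn : 0 < n) :
    truncatedTouchard (n + 1) k ≤ touchardMoment n k + 1 / 2 * truncatedTouchard n k := by
  rw [truncatedTouchard_succ]
  have h := sum_stirlingSecond_range_succ n k hn (fun _ => 1)
  simp only [one_mul, Finset.sum_range_succ] at h
  have h' : (0 : ℝ) ≤ (n.stirlingSecond k : ℝ) * (1 / 2) ^ k := by positivity
  rw [truncatedTouchard, ← h]
  linarith

/-- For the weights `S(n, p) 2 ^ (-p)`, `1 ≤ p ≤ k`, the mean of `p` increases by at most one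
from `n` to `n + 1`. -/
theorem touchardMoment_succ_mul_le (n k : ℕ) (hn : 0 < n) :
    touchardMoment (n + 1) k * truncatedTouchard n k ≤
      (touchardMoment n k + truncatedTouchard n k) * truncatedTouchard (n + 1) k := by
  set b : ℕ → ℝ := fun i => (n.stirlingSecond i : ℝ) * (1 / 2) ^ i with hb
  set b' : ℕ → ℝ := fun i => ((n + 1).stirlingSecond (i + 1) : ℝ) * (1 / 2) ^ (i + 1) with hb'
  have hb0 : ∀ i, 0 ≤ b i := fun i => by positivity
  have hb0' : ∀ i, 0 ≤ b' i := fun i => by positivity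
  have h1 : truncatedTouchard n k = ∑ q ∈ Finset.range (k + 1), b q := by
    have := sum_stirlingSecond_range_succ n k hn (fun _ => 1)
    simp only [one_mul] at this
    exact this.symm
  have h2 : touchardMoment n k = ∑ q ∈ Finset.range (k + 1), (q : ℝ) * b q := by
    have := sum_stirlingSecond_range_succ n k hn (fun i => (i : ℝ))
    push_cast at this
    exact this.symm
  have h3 : truncatedTouchard (n + 1) k = ∑ i ∈ Finset.range k, b' i := rfl
  have h4 : touchardMoment (n + 1) k = ∑ i ∈ Finset.range k, ((i : ℝ) + 1) * b' i := rfl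
  -- The difference of the two sides is `∑ i < k, ∑ q ≤ k, (i - q) b' i b q`. Its part `q < k` is
  -- symmetrised in `i` and `q`; in the part `q = k` all terms are nonpositive.
  have hsq : ∑ i ∈ Finset.range k, ∑ q ∈ Finset.range k, ((i : ℝ) - q) * (b' i * b q) ≤ 0 := by
    have hsymm : ∑ i ∈ Finset.range k, ∑ q ∈ Finset.range k, ((i : ℝ) - q) * (b' i * b q) =
        ∑ i ∈ Finset.range k, ∑ q ∈ Finset.range k, ((q : ℝ) - i) * (b' q * b i) :=
      Finset.sum_comm
    have hneg : ∑ i ∈ Finset.range k, ∑ q ∈ Finset.range k,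
        (((i : ℝ) - q) * (b' i * b q) + ((q : ℝ) - i) * (b' q * b i)) ≤ 0 := by
      refine Finset.sum_nonpos fun i _ => Finset.sum_nonpos fun q _ => ?_
      have key : ∀ {p q : ℕ}, p ≤ q → b' q * b p ≤ b' p * b q := by
        intro p q hpq
        have h : ((n + 1).stirlingSecond (q + 1) : ℝ) * n.stirlingSecond p ≤
            (n + 1).stirlingSecond (p + 1) * n.stirlingSecond q := by
          exact_mod_cast stirlingSecond_mul_le n hpq
        have := mul_le_mul_of_nonneg_right h (show (0 : ℝ) ≤ (1 / 2) ^ (p + q + 1) by positivity)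
        calc b' q * b p = (n + 1).stirlingSecond (q + 1) * n.stirlingSecond p *
              (1 / 2) ^ (p + q + 1) := by simp only [hb, hb']; ring
          _ ≤ _ := this
          _ = b' p * b q := by simp only [hb, hb']; ring
      rcases le_total i q with h | h
      · have h' : (i : ℝ) ≤ q := by exact_mod_cast h
        nlinarith [key h]
      · have h' : (q : ℝ) ≤ i := by exact_mod_cast h
        nlinarith [key h]
    simp only [Finset.sum_add_distrib] at hneg
    linarith
  have hlast : ∑ i ∈ Finset.range k, ((i : ℝ) - k) * (b' i * b k) ≤ 0 := by
    refine Finset.sum_nonpos fun i hi => mul_nonpos_of_nonpos_of_nonneg ?_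
      (mul_nonneg (hb0' i) (hb0 k))
    have : (i : ℝ) ≤ k := by exact_mod_cast (Finset.mem_range.1 hi).le
    linarith
  have hsum : touchardMoment (n + 1) k * truncatedTouchard n k -
      (touchardMoment n k + truncatedTouchard n k) * truncatedTouchard (n + 1) k =
      ∑ i ∈ Finset.range k, ∑ q ∈ Finset.range (k + 1), ((i : ℝ) - q) * (b' i * b q) := by
    rw [h1, h2, h3, h4, ← Finset.sum_add_distrib, mul_comm (∑ q ∈ Finset.range (k + 1), _),
      Finset.sum_mul_sum, Finset.sum_mul_sum, ← Finset.sum_sub_distrib]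
    refine Finset.sum_congr rfl fun i _ => ?_
    rw [← Finset.sum_sub_distrib]
    exact Finset.sum_congr rfl fun q _ => by ring
  simp only [Finset.sum_range_succ _ k, Finset.sum_add_distrib] at hsum
  linarith

/-- With `B n = truncatedTouchard n k`, and `E n` the mean number of blocks, `B (n + 1) / B n` lies
between `E n` and `E n + 1 / 2`, and `E (n + 1) ≤ E n + 1`; as `1 ≤ E n`, consecutive ratios differ
at most by the factor `5 / 2`. -/
theorem truncatedTouchard_mul_le (n k : ℕ) (hn : 0 < n) :
    truncatedTouchard n k * truncatedTouchard (n + 2) k ≤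
      5 / 2 * truncatedTouchard (n + 1) k ^ 2 := by
  have h0 : ∀ n, 0 ≤ truncatedTouchard n k := fun n => Finset.sum_nonneg fun i _ => by positivity
  have h1 := truncatedTouchard_succ_le (n + 1) k n.succ_pos
  have h2 := touchardMoment_succ_mul_le n k hn
  have h3 := truncatedTouchard_le_touchardMoment n k
  have h4 := touchardMoment_le_succ n k
  have hB := h0 n
  have hB1 := h0 (n + 1)
  calc _ ≤ truncatedTouchard n k *
        (touchardMoment (n + 1) k + 1 / 2 * truncatedTouchard (n + 1) k) := by gcongr
    _ ≤ (touchardMoment n k + 3 / 2 * truncatedTouchard n k) * truncatedTouchard (n + 1) k := by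
      linarith
    _ ≤ (5 / 2 * truncatedTouchard (n + 1) k) * truncatedTouchard (n + 1) k := by
      gcongr; linarith
    _ = _ := by ring

namespace CatalanModel

theorem lab_E_eq (n k : ℕ) : lab E n k = 2 ^ n * truncatedTouchard n k := by
  rw [lab, truncatedTouchard, sum_Icc_one_eq_sum_range]
  simp

/-- Up to a constant, the numbers of labellings are log-concave in the number of leaves, uniformly
in the number of variables. -/
theorem lab_mul_lab_le (m : CatalanModel) (n k : ℕ) (hn : 0 < n) :
    m.lab n k * m.lab (n + 2) k ≤ 5 / 2 * m.lab (n + 1) k ^ 2 := by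
  cases m with
  | G =>
    have h : (0 : ℝ) ≤ (2 * (k : ℝ)) ^ (2 * n + 2) := by positivity
    simp only [lab]
    rw [← pow_add, ← pow_mul, show n + (n + 2) = 2 * n + 2 by ring,
      show (n + 1) * 2 = 2 * n + 2 by ring]
    linarith
  | E =>
    rw [lab_E_eq, lab_E_eq, lab_E_eq]
    have h := mul_le_mul_of_nonneg_left (truncatedTouchard_mul_le n k hn)
      (show (0 : ℝ) ≤ 2 ^ n * 2 ^ (n + 2) by positivity)
    calc _ = 2 ^ n * 2 ^ (n + 2) * (truncatedTouchard n k * truncatedTouchard (n + 2) k) := by ring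
      _ ≤ _ := h
      _ = _ := by ring

theorem lab_pos (m : CatalanModel) {n k : ℕ} (hn : 0 < n) (hk : 0 < k) : 0 < m.lab n k := by
  cases m with
  | G => simp only [lab]; positivity
  | E =>
    rw [lab_E_eq]
    refine mul_pos (by positivity) (Finset.sum_pos' (fun i _ => by positivity)
      ⟨0, Finset.mem_range.2 hk, ?_⟩)
    obtain ⟨n, rfl⟩ := Nat.exists_eq_succ_of_ne_zero hn.ne'
    rw [Nat.succ_eq_add_one, zero_add, Nat.stirlingSecond_one_right]
    norm_num

/-- Removing `r` leaves costs at most a constant times the `r`-th power of the cost of removing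
one. -/
theorem lab_div_lab_le (m : CatalanModel) {n k : ℕ} (r : ℕ) (hn : 0 < n) (hk : 0 < k) :
    m.lab n k / m.lab (n + r) k ≤ (5 / 2) ^ (r ^ 2) * m.rat (n + r) k ^ r := by
  have hpos : ∀ {n}, 0 < n → 0 < m.lab n k := fun hn => m.lab_pos hn hk
  have hstep : ∀ n, 0 < n → m.rat (n + 1) k ≤ 5 / 2 * m.rat (n + 2) k := by
    intro n hn
    have h := m.lab_mul_lab_le n k hn
    have h1 := hpos (Nat.succ_pos n)
    have h2 := hpos (Nat.succ_pos (n + 1))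
    simp only [rat, Nat.add_sub_cancel, show n + 2 - 1 = n + 1 by omega]
    rw [← mul_div_assoc, div_le_div_iff₀ h1 h2]
    linarith
  have hrat : ∀ n, 0 < n → 0 < m.rat (n + 1) k := fun n hn =>
    div_pos (hpos hn) (hpos n.succ_pos)
  have hiter : ∀ j n, 0 < n → m.rat (n + 1) k ≤ (5 / 2) ^ j * m.rat (n + 1 + j) k := by
    intro j
    induction j with
    | zero => intro n _; simp
    | succ j ih =>
      intro n hn
      calc _ ≤ 5 / 2 * m.rat (n + 1 + 1) k := hstep n hn
        _ ≤ 5 / 2 * ((5 / 2) ^ j * m.rat (n + 1 + 1 + j) k) := by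
          gcongr; exact ih (n + 1) n.succ_pos
        _ = _ := by rw [show n + 1 + 1 + j = n + 1 + (j + 1) by ring, pow_succ]; ring
  have hmain : ∀ s ≤ r, m.lab n k / m.lab (n + s) k ≤
      ((5 / 2) ^ r * m.rat (n + r) k) ^ s := by
    intro s
    induction s with
    | zero => intro _; rw [add_zero, div_self (hpos hn).ne', pow_zero]
    | succ s ih =>
      intro hs
      have h1 := ih (by omega)
      have hns : 0 < n + s := by omega
      have h2 := hiter (r - (s + 1)) (n + s) hns
      rw [show n + s + 1 + (r - (s + 1)) = n + r by omega] at h2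
      have h3 : 0 < m.rat (n + r) k := by
        rw [show n + r = (n + r - 1) + 1 by omega]; exact hrat _ (by omega)
      have h4 : (5 / 2 : ℝ) ^ (r - (s + 1)) ≤ (5 / 2) ^ r :=
        pow_le_pow_right₀ (by norm_num) (Nat.sub_le _ _)
      have h5 : m.rat (n + s + 1) k ≤ (5 / 2) ^ r * m.rat (n + r) k := h2.trans (by gcongr)
      calc m.lab n k / m.lab (n + (s + 1)) k
          = m.lab n k / m.lab (n + s) k * m.rat (n + s + 1) k := by
            rw [rat, Nat.add_sub_cancel, ← add_assoc]
            have := (hpos hns).ne'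
            field_simp
        _ ≤ ((5 / 2) ^ r * m.rat (n + r) k) ^ s * ((5 / 2) ^ r * m.rat (n + r) k) :=
            mul_le_mul h1 h5 (hrat _ hns).le (by positivity)
        _ = _ := (pow_succ _ _).symm
  refine (hmain r le_rfl).trans (le_of_eq ?_)
  rw [mul_pow, ← pow_mul, sq]

end CatalanModel

/-! ### Words of literals up to equivalence -/

theorem Literal.ext_iff' {a b : Literal} : a = b ↔ a.var = b.var ∧ a.pos = b.pos := by
  cases a; cases b; simp

/-- There are only two literals on a given variable. -/
theorem Literal.eq_iff_of_var_eq_of_ne {a b : Literal} (hvar : a.var = b.var) (hne : a ≠ b)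
    (d : Literal) : a = d ↔ b.var = d.var ∧ b ≠ d := by
  rw [ne_eq, Literal.ext_iff'] at hne
  rw [ne_eq, Literal.ext_iff', Literal.ext_iff', ← hvar]
  rcases ha : a.pos <;> rcases hb : b.pos <;> rcases hd : d.pos <;> simp_all

/-- Two families of literals are equivalent if the coincidences between variables and the
coincidences between literals are the same in both. -/
def SameCoincidences {ι : Type} (w w' : ι → Literal) : Prop :=
  (∀ i j, (w i).var = (w j).var ↔ (w' i).var = (w' j).var) ∧ ∀ i j, w i = w j ↔ w' i = w' j

/-- The identification of labellings made by a model: none in `G`, equivalence in `E`. -/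
def wordSetoid (m : CatalanModel) (ι : Type) : Setoid (ι → Literal) where
  r w w' := match m with
    | .G => w = w'
    | .E => SameCoincidences w w'
  iseqv := by
    cases m with
    | G => exact ⟨fun _ => rfl, fun h => h.symm, fun h h' => h.trans h'⟩
    | E =>
      exact ⟨fun _ => ⟨fun _ _ => Iff.rfl, fun _ _ => Iff.rfl⟩,
        fun h => ⟨fun i j => (h.1 i j).symm, fun i j => (h.2 i j).symm⟩,
        fun h h' => ⟨fun i j => (h.1 i j).trans (h'.1 i j),
          fun i j => (h.2 i j).trans (h'.2 i j)⟩⟩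

/-- The class of a labelling in a model. -/
def wordClass (m : CatalanModel) {ι : Type} (w : ι → Literal) : Quotient (wordSetoid m ι) :=
  Quotient.mk _ w

theorem wordClass_G_eq_iff {ι : Type} {w w' : ι → Literal} :
    wordClass .G w = wordClass .G w' ↔ w = w' :=
  Quotient.eq

theorem wordClass_E_eq_iff {ι : Type} {w w' : ι → Literal} :
    wordClass .E w = wordClass .E w' ↔ SameCoincidences w w' :=
  Quotient.eq

theorem wordClass_comp (m : CatalanModel) {ι κ : Type} (f : κ → ι) {w w' : ι → Literal}
    (h : wordClass m w = wordClass m w') : wordClass m (w ∘ f) = wordClass m (w' ∘ f) := by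
  cases m with
  | G => rw [wordClass_G_eq_iff] at h ⊢; rw [h]
  | E =>
    rw [wordClass_E_eq_iff] at h ⊢
    exact ⟨fun i j => h.1 (f i) (f j), fun i j => h.2 (f i) (f j)⟩

/-- If the labels at `i` and `j` have the same variable, the class of a labelling is determined by
its restriction away from `j` and by whether the labels at `i` and `j` agree. -/
theorem wordClass_eq_of_restrict (m : CatalanModel) {ι : Type} {i j : ι} (hij : i ≠ j)
    {w w' : ι → Literal} (hw : (w i).var = (w j).var) (hw' : (w' i).var = (w' j).var)
    (hs : w i = w j ↔ w' i = w' j)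
    (h : wordClass m (fun a : {a // a ≠ j} => w a) = wordClass m (fun a : {a // a ≠ j} => w' a)) :
    wordClass m w = wordClass m w' := by
  classical
  cases m with
  | G =>
    rw [wordClass_G_eq_iff] at h ⊢
    have h' : ∀ a, a ≠ j → w a = w' a := fun a ha => congrFun h ⟨a, ha⟩
    funext a
    by_cases ha : a = j
    swap
    · exact h' a ha
    subst ha
    have hi := h' i hij
    by_cases he : w i = w a
    · rw [← he, ← hs.1 he, hi]
    · rw [Literal.eq_iff_of_var_eq_of_ne hw.symm (Ne.symm he), hi]
      exact ⟨hw', fun h'' => he (hs.2 h'')⟩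
  | E =>
    rw [wordClass_E_eq_iff] at h ⊢
    have hv : ∀ a b, a ≠ j → b ≠ j → ((w a).var = (w b).var ↔ (w' a).var = (w' b).var) :=
      fun a b ha hb => h.1 ⟨a, ha⟩ ⟨b, hb⟩
    have hl : ∀ a b, a ≠ j → b ≠ j → (w a = w b ↔ w' a = w' b) :=
      fun a b ha hb => h.2 ⟨a, ha⟩ ⟨b, hb⟩
    have hl' : ∀ b, b ≠ j → (w j = w b ↔ w' j = w' b) := by
      intro b hb
      by_cases he : w i = w j
      · rw [← he, ← hs.1 he]; exact hl i b hij hb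
      · rw [Literal.eq_iff_of_var_eq_of_ne hw.symm (Ne.symm he),
          Literal.eq_iff_of_var_eq_of_ne hw'.symm (Ne.symm (fun h => he (hs.2 h))),
          hv i b hij hb, ne_eq, ne_eq, hl i b hij hb]
    refine ⟨fun a b => ?_, fun a b => ?_⟩
    · by_cases ha : a = j <;> by_cases hb : b = j
      · rw [ha, hb]; simp
      · rw [ha, ← hw, ← hw']; exact hv i b hij hb
      · rw [hb, ← hw, ← hw']; exact hv a i ha hij
      · exact hv a b ha hb
    · by_cases ha : a = j <;> by_cases hb : b = j
      · rw [ha, hb]; simp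
      · rw [ha]; exact hl' b hb
      · rw [hb, eq_comm, hl' a ha, eq_comm]
      · exact hl a b ha hb

/-- The labellings that use the first `k` variables only. -/
def boundedWords (ι : Type) (k : ℕ) : Set (ι → Literal) := {w | ∀ i, (w i).var < k}

theorem boundedWords_eq_range (ι : Type) (k : ℕ) : boundedWords ι k =
    Set.range fun (f : ι → Fin k × Bool) (i : ι) => (⟨(f i).1, (f i).2⟩ : Literal) := by
  ext w
  constructor
  · intro h
    exact ⟨fun i => (⟨(w i).var, h i⟩, (w i).pos), rfl⟩
  · rintro ⟨f, rfl⟩ i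
    exact (f i).1.2

theorem finite_boundedWords (ι : Type) [Finite ι] (k : ℕ) : (boundedWords ι k).Finite := by
  rw [boundedWords_eq_range]
  exact Set.finite_range _

/-- The number of labellings of `n` leaves by the first `k` variables in a model. -/
noncomputable def wordCount (m : CatalanModel) (n k : ℕ) : ℕ :=
  (wordClass m '' boundedWords (Fin n) k).ncard

/-- If `g` maps `U` into `V` and determines `f` on `U`, then `f` has at most `|V|` values on `U`. -/
theorem ncard_image_le_of_factor {α β γ : Type*} {f : α → β} {g : α → γ} {U : Set α} {V : Set γ}
    (hV : V.Finite) (hg : ∀ x ∈ U, g x ∈ V)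
    (hfg : ∀ x ∈ U, ∀ y ∈ U, g x = g y → f x = f y) : (f '' U).ncard ≤ V.ncard := by
  rcases U.eq_empty_or_nonempty with rfl | ⟨x₀, hx₀⟩
  · simp
  have : Nonempty α := ⟨x₀⟩
  have hsub : g '' U ⊆ V := Set.image_subset_iff.2 hg
  have heq : f '' U = (f ∘ Function.invFunOn g U) '' (g '' U) := by
    rw [Set.image_image]
    refine Set.image_congr fun x hx => ?_
    have hex : ∃ a ∈ U, g a = g x := ⟨x, hx, rfl⟩
    exact hfg x hx _ (Function.invFunOn_mem hex) (Function.invFunOn_eq hex).symm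
  rw [heq]
  exact (Set.ncard_image_le (hV.subset hsub)).trans (Set.ncard_le_ncard hsub hV)

theorem ncard_wordClass_boundedWords_le (m : CatalanModel) (ι : Type) [Fintype ι] (k : ℕ) :
    (wordClass m '' boundedWords ι k).ncard ≤ wordCount m (Fintype.card ι) k := by
  let e := Fintype.equivFin ι
  refine ncard_image_le_of_factor (g := fun w => wordClass m (w ∘ e.symm))
    ((finite_boundedWords _ k).image _) (fun w hw => ⟨_, fun i => hw _, rfl⟩) ?_
  intro w _ w' _ h
  have := wordClass_comp m e h
  simpa [Function.comp_assoc] using this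

/-- The repeated leaves may be removed one after the other: each time there are at most `|P| ^ 2`
choices for the leaf `j` removed and a leaf `i` with the same variable, and the label at `j` is then
determined up to its sign. -/
theorem ncard_wordClass_repetitions_le (m : CatalanModel) (k r : ℕ) (ι : Type) [Fintype ι]
    (P : Finset ι) :
    (wordClass m '' {w | w ∈ boundedWords ι k ∧
      r + (P.image fun i => (w i).var).card ≤ P.card}).ncard ≤
      (2 * P.card ^ 2) ^ r * wordCount m (Fintype.card ι - r) k := by
  classical
  induction r generalizing ι with
  | zero =>
    rw [pow_zero, one_mul, Nat.sub_zero]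
    exact (Set.ncard_le_ncard (Set.image_mono fun w hw => hw.1)
      ((finite_boundedWords ι k).image _)).trans (ncard_wordClass_boundedWords_le m ι k)
  | succ r ih =>
    set T : ι × ι → Set (ι → Literal) := fun ij =>
      {w | w ∈ boundedWords ι k ∧ (w ij.1).var = (w ij.2).var ∧
        r + ((P.subtype (· ≠ ij.2)).image fun i : {a // a ≠ ij.2} => (w i).var).card ≤
          (P.subtype (· ≠ ij.2)).card} with hT
    have hcard : ∀ j ∈ P, (P.subtype (· ≠ j)).card = P.card - 1 := by
      intro j hj
      rw [Finset.card_subtype, Finset.filter_ne', Finset.card_erase_of_mem hj]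
    have hsub : wordClass m '' {w | w ∈ boundedWords ι k ∧
        r + 1 + (P.image fun i => (w i).var).card ≤ P.card} ⊆
        ⋃ ij ∈ P.offDiag, wordClass m '' T ij := by
      rintro _ ⟨w, ⟨hw, hrep⟩, rfl⟩
      obtain ⟨i, hi, j, hj, hij, hvar⟩ := Finset.exists_ne_map_eq_of_card_lt_of_maps_to
        (show (P.image fun i => (w i).var).card < P.card by omega)
        (fun i hi => Finset.mem_image_of_mem (fun i => (w i).var) hi)
      refine Set.mem_biUnion (x := (i, j)) (Finset.mem_offDiag.2 ⟨hi, hj, hij⟩)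
        ⟨w, ⟨hw, hvar, ?_⟩, rfl⟩
      have hle : ((P.subtype (· ≠ j)).image fun i : {a // a ≠ j} => (w i).var).card ≤
          (P.image fun i => (w i).var).card := by
        refine Finset.card_le_card fun v hv => ?_
        obtain ⟨a, ha, rfl⟩ := Finset.mem_image.1 hv
        exact Finset.mem_image_of_mem (fun i => (w i).var) (Finset.mem_subtype.1 ha)
      have := hcard j hj
      dsimp only
      omega
    have hbound : ∀ ij ∈ P.offDiag, (wordClass m '' T ij).ncard ≤
        2 * ((2 * P.card ^ 2) ^ r * wordCount m (Fintype.card ι - (r + 1)) k) := by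
      rintro ⟨i, j⟩ hmem
      obtain ⟨hi, hj, hij⟩ := Finset.mem_offDiag.1 hmem
      set V := wordClass m '' {w | w ∈ boundedWords {a // a ≠ j} k ∧
        r + ((P.subtype (· ≠ j)).image fun i => (w i).var).card ≤ (P.subtype (· ≠ j)).card}
        with hV
      have hVfin : V.Finite := ((finite_boundedWords _ k).subset fun w hw => hw.1).image _
      have h1 : (wordClass m '' T (i, j)).ncard ≤ (V ×ˢ (Set.univ : Set Bool)).ncard := by
        refine ncard_image_le_of_factor
          (g := fun w => (wordClass m (fun a : {a // a ≠ j} => w a), decide (w i = w j)))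
          (hVfin.prod Set.finite_univ) ?_ ?_
        · rintro w ⟨hw, -, hrep⟩
          exact ⟨⟨_, ⟨fun a => hw a, hrep⟩, rfl⟩, trivial⟩
        · rintro w ⟨-, hw, -⟩ w' ⟨-, hw', -⟩ h
          rw [Prod.mk.injEq, decide_eq_decide] at h
          exact wordClass_eq_of_restrict m hij hw hw' h.2 h.1
      have h2 := ih {a // a ≠ j} (P.subtype (· ≠ j))
      rw [Fintype.card_subtype_compl, Fintype.card_subtype_eq, Nat.sub_sub,
        add_comm 1 r] at h2
      rw [Set.ncard_prod, Set.ncard_univ, Nat.card_eq_fintype_card, Fintype.card_bool,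
        mul_comm] at h1
      refine h1.trans (Nat.mul_le_mul_left 2 (h2.trans ?_))
      have := hcard j hj
      gcongr
      omega
    have hfin : (⋃ ij ∈ P.offDiag, wordClass m '' T ij).Finite :=
      P.offDiag.finite_toSet.biUnion fun ij _ =>
        ((finite_boundedWords ι k).subset fun w hw => hw.1).image _
    calc _ ≤ (⋃ ij ∈ P.offDiag, wordClass m '' T ij).ncard := Set.ncard_le_ncard hsub hfin
      _ ≤ ∑ ij ∈ P.offDiag, (wordClass m '' T ij).ncard := Finset.set_ncard_biUnion_le _ _
      _ ≤ P.offDiag.card • (2 * ((2 * P.card ^ 2) ^ r *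
          wordCount m (Fintype.card ι - (r + 1)) k)) := Finset.sum_le_card_nsmul _ _ _ hbound
      _ ≤ P.card ^ 2 * (2 * ((2 * P.card ^ 2) ^ r *
          wordCount m (Fintype.card ι - (r + 1)) k)) := by
        rw [smul_eq_mul, Finset.offDiag_card, sq]
        exact Nat.mul_le_mul_right _ (Nat.sub_le _ _)
      _ = _ := by ring

/-! ### Canonical representatives of the equivalence classes of words -/

/-- The canonical words of length `n` with `p` variables: the last letter is `x_0`, and each letter
before it either uses a variable to its right or is the positive literal on the first variable
not yet used. -/
def canonicalWords : (n : ℕ) → ℕ → Set (Fin n → Literal)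
  | 0, p => {_w | p = 0}
  | n + 1, p => {w | (Fin.tail w ∈ canonicalWords n p ∧ (w 0).var < p) ∨
      ∃ p', p = p' + 1 ∧ Fin.tail w ∈ canonicalWords n p' ∧ w 0 = ⟨p', true⟩}

/-- The parameter `p` is the number of variables that occur: these are `x_0, …, x_{p - 1}`. -/
theorem canonicalWords_var {n p : ℕ} {w : Fin n → Literal} (hw : w ∈ canonicalWords n p) (v : ℕ) :
    v < p ↔ ∃ i, (w i).var = v := by
  revert v
  induction n generalizing p with
  | zero =>
    have : p = 0 := hw
    simp [this]
  | succ n ih =>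
    intro v
    rw [Fin.exists_fin_succ]
    rcases hw with ⟨hw, h0⟩ | ⟨p', rfl, hw, h0⟩
    · rw [ih hw v]
      refine ⟨Or.inr, ?_⟩
      rintro (rfl | h)
      · exact (ih hw _).1 h0
      · exact h
    · have := ih hw v
      simp only [Fin.tail] at this
      rw [← this, h0]
      dsimp only
      omega

theorem sameCoincidences_succ_iff {n : ℕ} {w w' : Fin (n + 1) → Literal} :
    SameCoincidences w w' ↔ SameCoincidences (Fin.tail w) (Fin.tail w') ∧
      ∀ j, ((w 0).var = (Fin.tail w j).var ↔ (w' 0).var = (Fin.tail w' j).var) ∧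
        (w 0 = Fin.tail w j ↔ w' 0 = Fin.tail w' j) := by
  constructor
  · intro h
    exact ⟨⟨fun i j => h.1 _ _, fun i j => h.2 _ _⟩, fun j => ⟨h.1 _ _, h.2 _ _⟩⟩
  · rintro ⟨⟨h1, h2⟩, h⟩
    refine ⟨fun i j => ?_, fun i j => ?_⟩
    · refine Fin.cases ?_ (fun i => ?_) i <;> refine Fin.cases ?_ (fun j => ?_) j
      · simp
      · exact (h j).1
      · rw [eq_comm, eq_comm (b := (w' 0).var)]; exact (h i).1
      · exact h1 i j
    · refine Fin.cases ?_ (fun i => ?_) i <;> refine Fin.cases ?_ (fun j => ?_) j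
      · simp
      · exact (h j).2
      · rw [eq_comm, eq_comm (b := w' 0)]; exact (h i).2
      · exact h2 i j

theorem canonicalWords_index_unique {n p p' : ℕ} {w : Fin n → Literal}
    (hw : w ∈ canonicalWords n p) (hw' : w ∈ canonicalWords n p') : p = p' :=
  eq_of_forall_lt_iff fun v => (canonicalWords_var hw v).trans (canonicalWords_var hw' v).symm

theorem canonicalWords_eq_of_sameCoincidences {n p p' : ℕ} {w w' : Fin n → Literal}
    (hw : w ∈ canonicalWords n p) (hw' : w' ∈ canonicalWords n p') (h : SameCoincidences w w') :
    w = w' := by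
  induction n generalizing p p' with
  | zero => exact Subsingleton.elim _ _
  | succ n ih =>
    obtain ⟨ht, h0⟩ := sameCoincidences_succ_iff.1 h
    -- A letter repeating a variable of the tail is determined by its coincidences with the tail.
    have hold : ∀ q q' : ℕ, Fin.tail w ∈ canonicalWords n q → Fin.tail w' ∈ canonicalWords n q' →
        (w 0).var < q → w 0 = w' 0 := by
      intro q q' hq hq' hlt
      have hteq := ih hq hq' ht
      rw [← hteq] at h0
      obtain ⟨i, hi⟩ := (canonicalWords_var hq _).1 hlt
      have h1 := (h0 i).1.1 hi.symm
      by_cases he : w 0 = Fin.tail w i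
      · rw [he, (h0 i).2.1 he]
      · rw [Literal.eq_iff_of_var_eq_of_ne hi.symm he]
        exact ⟨h1.symm, fun h => he ((h0 i).2.2 h.symm)⟩
    have hhead : Fin.tail w = Fin.tail w' ∧ w 0 = w' 0 := by
      rcases hw with ⟨hw, hv⟩ | ⟨q, rfl, hw, hv⟩
      · rcases hw' with ⟨hw', -⟩ | ⟨q', rfl, hw', -⟩ <;>
          exact ⟨ih hw hw' ht, hold _ _ hw hw' hv⟩
      · rcases hw' with ⟨hw', hv'⟩ | ⟨q', rfl, hw', hv'⟩
        · obtain ⟨i, hi⟩ := (canonicalWords_var hw' _).1 hv'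
          have h1 := (h0 i).1.2 hi.symm
          rw [hv] at h1
          exact absurd ((canonicalWords_var hw _).2 ⟨i, h1.symm⟩) (lt_irrefl _)
        · have hteq := ih hw hw' ht
          refine ⟨hteq, ?_⟩
          rw [hteq] at hw
          rw [hv, hv', canonicalWords_index_unique hw hw']
    rw [← Fin.cons_self_tail w, ← Fin.cons_self_tail w', hhead.1, hhead.2]

theorem exists_canonicalWords_sameCoincidences {n : ℕ} (w : Fin n → Literal) :
    ∃ p, ∃ c ∈ canonicalWords n p, SameCoincidences w c := by
  classical
  induction n with
  | zero =>
    exact ⟨0, w, rfl, fun i => i.elim0, fun i => i.elim0⟩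
  | succ n ih =>
    obtain ⟨p, c, hc, hwc⟩ := ih (Fin.tail w)
    by_cases hold : ∃ i, (w 0).var = (Fin.tail w i).var
    · obtain ⟨i, hi⟩ := hold
      have hci : (c i).var < p := (canonicalWords_var hc _).2 ⟨i, rfl⟩
      by_cases he : w 0 = Fin.tail w i
      · refine ⟨p, Fin.cons (c i) c, Or.inl ⟨by rwa [Fin.tail_cons], by rwa [Fin.cons_zero]⟩, ?_⟩
        rw [sameCoincidences_succ_iff, Fin.tail_cons, Fin.cons_zero, he]
        exact ⟨hwc, fun j => ⟨hwc.1 i j, hwc.2 i j⟩⟩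
      · refine ⟨p, Fin.cons ⟨(c i).var, !(c i).pos⟩ c,
          Or.inl ⟨by rwa [Fin.tail_cons], by rwa [Fin.cons_zero]⟩, ?_⟩
        rw [sameCoincidences_succ_iff, Fin.tail_cons, Fin.cons_zero]
        refine ⟨hwc, fun j => ⟨?_, ?_⟩⟩
        · rw [hi]; exact hwc.1 i j
        · have hne : (⟨(c i).var, !(c i).pos⟩ : Literal) ≠ c i := by
            rw [ne_eq, Literal.ext_iff']; simp
          have hvar : (⟨(c i).var, !(c i).pos⟩ : Literal).var = (c i).var := rfl
          rw [Literal.eq_iff_of_var_eq_of_ne hi he, Literal.eq_iff_of_var_eq_of_ne hvar hne,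
            hwc.1 i j, ne_eq, ne_eq, hwc.2 i j]
    · refine ⟨p + 1, Fin.cons ⟨p, true⟩ c,
        Or.inr ⟨p, rfl, by rwa [Fin.tail_cons], Fin.cons_zero _ _⟩, ?_⟩
      rw [sameCoincidences_succ_iff, Fin.tail_cons, Fin.cons_zero]
      have h1 : ∀ j, (w 0).var ≠ (Fin.tail w j).var := fun j h => hold ⟨j, h⟩
      have h2 : ∀ j, p ≠ (c j).var := fun j h =>
        lt_irrefl p ((canonicalWords_var hc _).2 ⟨j, h.symm⟩)
      refine ⟨hwc, fun j => ⟨iff_of_false (h1 j) (h2 j), iff_of_false ?_ ?_⟩⟩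
      · exact fun h => h1 j (congrArg _ h)
      · exact fun h => h2 j (congrArg Literal.var h)

theorem canonicalWords_le {n p k : ℕ} {w c : Fin n → Literal} (hc : c ∈ canonicalWords n p)
    (hw : w ∈ boundedWords (Fin n) k) (h : SameCoincidences w c) : p ≤ k := by
  have hex : ∀ v : Fin p, ∃ i, (c i).var = v := fun v => (canonicalWords_var hc v).1 v.2
  choose i hi using hex
  have := Fintype.card_le_of_injective (fun v : Fin p => (⟨(w (i v)).var, hw _⟩ : Fin k)) ?_
  · simpa using this
  · intro v v' hv
    have := (h.1 _ _).1 (congrArg Fin.val hv)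
    rw [hi, hi] at this
    exact Fin.ext this

theorem canonicalWords_subset_boundedWords (n p : ℕ) :
    canonicalWords n p ⊆ boundedWords (Fin n) p :=
  fun _ hw i => (canonicalWords_var hw _).2 ⟨i, rfl⟩

theorem finite_canonicalWords (n p : ℕ) : (canonicalWords n p).Finite :=
  (finite_boundedWords (Fin n) p).subset (canonicalWords_subset_boundedWords n p)

theorem canonicalWords_succ_zero (n : ℕ) : canonicalWords (n + 1) 0 = ∅ := by
  ext w
  simp [canonicalWords]

/-- A word is prolonged by one of the `2 (p + 1)` old literals or by the new variable. -/
theorem ncard_canonicalWords_succ_succ (n p : ℕ) : (canonicalWords (n + 1) (p + 1)).ncard =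
    2 * (p + 1) * (canonicalWords n (p + 1)).ncard + (canonicalWords n p).ncard := by
  set F : (Fin (p + 1) × Bool) × (Fin n → Literal) → Fin (n + 1) → Literal :=
    fun x => Fin.cons ⟨x.1.1, x.1.2⟩ x.2 with hF
  set F' : (Fin n → Literal) → Fin (n + 1) → Literal := fun x => Fin.cons ⟨p, true⟩ x with hF'
  have heq : canonicalWords (n + 1) (p + 1) =
      F '' (Set.univ ×ˢ canonicalWords n (p + 1)) ∪ F' '' canonicalWords n p := by
    ext w
    constructor
    · rintro (⟨hw, hv⟩ | ⟨p', hp, hw, hv⟩)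
      · exact Or.inl ⟨((⟨_, hv⟩, (w 0).pos), Fin.tail w), ⟨trivial, hw⟩, Fin.cons_self_tail w⟩
      · obtain rfl : p = p' := by omega
        refine Or.inr ⟨Fin.tail w, hw, ?_⟩
        rw [hF']
        dsimp only
        rw [← hv, Fin.cons_self_tail]
    · rintro (⟨⟨⟨v, b⟩, c⟩, ⟨-, hc⟩, rfl⟩ | ⟨c, hc, rfl⟩)
      · exact Or.inl ⟨by simpa [hF] using hc, by simp [hF]; omega⟩
      · exact Or.inr ⟨p, rfl, by simpa [hF'] using hc, by simp [hF']⟩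
  have hFinj : Function.Injective F := by
    rintro ⟨⟨v, b⟩, c⟩ ⟨⟨v', b'⟩, c'⟩ h
    simp only [hF, Fin.cons_inj, Literal.mk.injEq] at h
    obtain ⟨⟨h1, rfl⟩, rfl⟩ := h
    rw [Fin.ext h1]
  have hFinj' : Function.Injective F' := fun c c' h => (Fin.cons_inj.1 h).2
  rw [heq, Set.ncard_union_eq ?_
    ((Set.finite_univ.prod (finite_canonicalWords n _)).image _)
    ((finite_canonicalWords n _).image _), Set.ncard_image_of_injective _ hFinj,
    Set.ncard_image_of_injective _ hFinj', Set.ncard_prod, Set.ncard_univ,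
    Nat.card_eq_fintype_card, Fintype.card_prod, Fintype.card_fin, Fintype.card_bool]
  · ring
  · refine Set.disjoint_left.2 ?_
    rintro _ ⟨⟨⟨v, b⟩, c⟩, ⟨-, hc⟩, rfl⟩ ⟨c', hc', h⟩
    simp only [hF, hF', Fin.cons_inj] at h
    obtain ⟨-, rfl⟩ := h
    exact absurd (canonicalWords_index_unique hc hc') (Nat.succ_ne_self p)

theorem two_pow_mul_ncard_canonicalWords (n p : ℕ) :
    2 ^ p * (canonicalWords n p).ncard = 2 ^ n * n.stirlingSecond p := by
  induction n generalizing p with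
  | zero =>
    rcases p with _ | p
    · have : canonicalWords 0 0 = Set.univ := by ext w; simp [canonicalWords]
      rw [this, Set.ncard_univ]
      simp
    · have : canonicalWords 0 (p + 1) = ∅ := by ext w; simp [canonicalWords]
      rw [this]
      simp
  | succ n ih =>
    rcases p with _ | p
    · rw [canonicalWords_succ_zero]; simp
    · rw [ncard_canonicalWords_succ_succ, Nat.stirlingSecond_succ_succ]
      calc _ = 2 * (p + 1) * (2 ^ (p + 1) * (canonicalWords n (p + 1)).ncard) +
            2 * (2 ^ p * (canonicalWords n p).ncard) := by ring
        _ = _ := by rw [ih, ih]; ring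

theorem wordCount_G (n k : ℕ) : wordCount .G n k = (2 * k) ^ n := by
  have hinj : Function.Injective (wordClass .G : (Fin n → Literal) → _) :=
    fun _ _ h => wordClass_G_eq_iff.1 h
  have hinj' : Function.Injective
      fun (f : Fin n → Fin k × Bool) (i : Fin n) => (⟨(f i).1, (f i).2⟩ : Literal) := by
    intro f f' h
    funext i
    have := congrFun h i
    simp only [Literal.mk.injEq] at this
    exact Prod.ext (Fin.ext this.1) this.2
  rw [wordCount, Set.ncard_image_of_injective _ hinj, boundedWords_eq_range, ← Set.image_univ,
    Set.ncard_image_of_injective _ hinj', Set.ncard_univ]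
  simp [mul_comm]

theorem wordCount_E (n k : ℕ) :
    wordCount .E n k = ∑ p ∈ Finset.range (k + 1), (canonicalWords n p).ncard := by
  have heq : wordClass .E '' boundedWords (Fin n) k =
      wordClass .E '' ⋃ p ∈ (Finset.range (k + 1) : Set ℕ), canonicalWords n p := by
    ext x
    constructor
    · rintro ⟨w, hw, rfl⟩
      obtain ⟨p, c, hc, h⟩ := exists_canonicalWords_sameCoincidences w
      refine ⟨c, Set.mem_biUnion ?_ hc, (wordClass_E_eq_iff.2 h).symm⟩
      have := canonicalWords_le hc hw h
      simp only [Finset.coe_range, Set.mem_Iio]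
      omega
    · rintro ⟨c, hc, rfl⟩
      obtain ⟨p, hp, hc⟩ := Set.mem_iUnion₂.1 hc
      refine ⟨c, fun i => ?_, rfl⟩
      have := canonicalWords_subset_boundedWords n p hc i
      simp only [Finset.coe_range, Set.mem_Iio] at hp
      omega
  rw [wordCount, heq, Set.InjOn.ncard_image, (Finset.finite_toSet _).ncard_biUnion,
    finsum_mem_coe_finset]
  · exact fun p _ => finite_canonicalWords n p
  · exact fun p _ p' _ hne => Set.disjoint_left.2 fun w hw hw' =>
      hne (canonicalWords_index_unique hw hw')
  · intro w hw w' hw' h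
    obtain ⟨p, -, hc⟩ := Set.mem_iUnion₂.1 hw
    obtain ⟨p', -, hc'⟩ := Set.mem_iUnion₂.1 hw'
    exact canonicalWords_eq_of_sameCoincidences hc hc' (wordClass_E_eq_iff.1 h)

/-- The quantity `lab` does count labellings. The hypothesis `0 < n` is needed in model `E`, where
the sum defining `lab` starts at `p = 1`. -/
theorem wordCount_eq_lab (m : CatalanModel) {n : ℕ} (hn : 0 < n) (k : ℕ) :
    (wordCount m n k : ℝ) = m.lab n k := by
  cases m with
  | G => rw [wordCount_G, CatalanModel.lab]; push_cast; rfl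
  | E =>
    obtain ⟨n, rfl⟩ := Nat.exists_eq_succ_of_ne_zero hn.ne'
    rw [wordCount_E, CatalanModel.lab_E_eq, Finset.sum_range_succ', canonicalWords_succ_zero,
      Set.ncard_empty, add_zero, truncatedTouchard, Finset.mul_sum]
    push_cast
    refine Finset.sum_congr rfl fun p _ => ?_
    have h : (2 : ℝ) ^ (p + 1) * (canonicalWords (n + 1) (p + 1)).ncard =
        2 ^ (n + 1) * (n + 1).stirlingSecond (p + 1) := by
      exact_mod_cast two_pow_mul_ncard_canonicalWords (n + 1) (p + 1)
    rw [← mul_assoc, Nat.succ_eq_add_one, ← h]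
    have h2 : (2 : ℝ) ^ (p + 1) * (1 / 2) ^ (p + 1) = 1 := by rw [← mul_pow]; norm_num
    linear_combination -((canonicalWords (n + 1) (p + 1)).ncard : ℝ) * h2

/-! ### And/or trees as pairs of a tree-structure and a word -/

namespace BTree

/-- Relabel the leaves of a tree. -/
def map {α β : Type} (f : α → β) : BTree α → BTree β
  | leaf a => leaf (f a)
  | node c l r => node c (map f l) (map f r)

/-- Label the leaves of a tree, from left to right, by the consecutive integers from `s` on. -/
def index {α : Type} : BTree α → ℕ → BTree ℕ
  | leaf _, s => leaf s
  | node c l r, s => node c (index l s) (index r (s + l.size))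

theorem leaves_map {α β : Type} (f : α → β) (t : BTree α) : (t.map f).leaves = t.leaves.map f := by
  induction t with
  | leaf a => rfl
  | node c l r hl hr => simp [map, leaves, hl, hr]

theorem shape_map {α β : Type} (f : α → β) (t : BTree α) : (t.map f).shape = t.shape := by
  induction t with
  | leaf a => rfl
  | node c l r hl hr => simp [map, shape, hl, hr]

theorem size_shape {α : Type} (t : BTree α) : t.shape.size = t.size := by
  induction t with
  | leaf a => rfl
  | node c l r hl hr => rw [shape, size_node, size_node, hl, hr]

theorem leaves_index {α : Type} (t : BTree α) (s : ℕ) :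
    (t.index s).leaves = List.range' s t.size := by
  induction t generalizing s with
  | leaf a => rfl
  | node c l r hl hr =>
    rw [index, leaves, hl, hr, size_node, List.range'_append_1]

theorem shape_index (t : TreeStructure) (s : ℕ) : (t.index s).shape = t := by
  induction t generalizing s with
  | leaf a => rfl
  | node c l r hl hr => rw [index, shape, hl, hr]

theorem eq_of_shape_of_leaves {α : Type} {t t' : BTree α} (hs : t.shape = t'.shape)
    (hl : t.leaves = t'.leaves) : t = t' := by
  induction t generalizing t' with
  | leaf a =>
    cases t' with
    | leaf b => simpa [leaves] using hl
    | node c l r => simp [shape] at hs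
  | node c l r ihl ihr =>
    cases t' with
    | leaf b => simp [shape] at hs
    | node c' l' r' =>
      simp only [shape, node.injEq] at hs
      have hlen : l.leaves.length = l'.leaves.length := by
        have h1 := size_shape l
        rw [hs.2.1, size_shape] at h1
        exact h1.symm
      obtain ⟨h1, h2⟩ := List.append_inj hl hlen
      rw [hs.1, ihl hs.2.1 h1, ihr hs.2.2 h2]

end BTree

/-- The labels of the leaves of an and/or tree of size `n`, as a word of length `n`.  (Positions
beyond the last leaf receive the first literal.) -/
def treeWord (n : ℕ) (t : AndOrTree) (i : Fin n) : Literal := t.leaves.getD i ⟨0, true⟩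

/-- The and/or tree with given tree-structure, of size `n`, and given leaf labels. -/
def labelledTree {n : ℕ} (σ : TreeStructure) (w : Fin n → Literal) : AndOrTree :=
  (σ.index 0).map fun i => if h : i < n then w ⟨i, h⟩ else ⟨0, true⟩

theorem getElem?_leaves {n : ℕ} {t : AndOrTree} (ht : t.size = n) (i : ℕ) :
    t.leaves[i]? = if h : i < n then some (treeWord n t ⟨i, h⟩) else none := by
  have hlen : t.leaves.length = n := ht
  split_ifs with h
  · have h' : i < t.leaves.length := hlen ▸ h
    simp [treeWord, List.getD_eq_getElem?_getD, List.getElem?_eq_getElem h']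
  · exact List.getElem?_eq_none (by omega)

theorem eq_map_index (t : AndOrTree) :
    t = (t.shape.index 0).map fun i => t.leaves.getD i ⟨0, true⟩ := by
  refine BTree.eq_of_shape_of_leaves ?_ ?_
  · rw [BTree.shape_map, BTree.shape_index]
  · rw [BTree.leaves_map, BTree.leaves_index, BTree.size_shape]
    refine List.ext_getElem (by simp [BTree.size]) fun i h1 h2 => ?_
    simp [List.getD_eq_getElem?_getD, h1]

theorem shape_labelledTree {n : ℕ} (σ : TreeStructure) (w : Fin n → Literal) :
    (labelledTree σ w).shape = σ := by
  rw [labelledTree, BTree.shape_map, BTree.shape_index]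

theorem leaves_labelledTree {n : ℕ} {σ : TreeStructure} (hσ : σ.size = n) (w : Fin n → Literal) :
    (labelledTree σ w).leaves = List.ofFn w := by
  rw [labelledTree, BTree.leaves_map, BTree.leaves_index, hσ]
  refine List.ext_getElem (by simp) fun i h1 h2 => ?_
  have : i < n := by simpa using h2
  simp [this]

theorem size_labelledTree {n : ℕ} {σ : TreeStructure} (hσ : σ.size = n) (w : Fin n → Literal) :
    (labelledTree σ w).size = n := by
  rw [BTree.size, leaves_labelledTree hσ, List.length_ofFn]

theorem treeWord_labelledTree {n : ℕ} {σ : TreeStructure} (hσ : σ.size = n) (w : Fin n → Literal) :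
    treeWord n (labelledTree σ w) = w := by
  funext i
  rw [treeWord, leaves_labelledTree hσ]
  simp [List.getD_eq_getElem?_getD]

theorem labelledTree_treeWord {n : ℕ} {t : AndOrTree} (ht : t.size = n) :
    labelledTree t.shape (treeWord n t) = t := by
  have hσ : t.shape.size = n := (BTree.size_shape t).trans ht
  refine BTree.eq_of_shape_of_leaves (shape_labelledTree _ _) ?_
  rw [leaves_labelledTree hσ]
  refine List.ext_getElem (by rw [List.length_ofFn]; exact ht.symm) fun i h1 h2 => ?_
  simp [treeWord, List.getD_eq_getElem?_getD, h2]

theorem usesFirst_iff {n : ℕ} {t : AndOrTree} (ht : t.size = n) (k : ℕ) :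
    AndOrTree.UsesFirst k t ↔ treeWord n t ∈ boundedWords (Fin n) k := by
  have hleaves := leaves_labelledTree ((BTree.size_shape t).trans ht) (treeWord n t)
  rw [labelledTree_treeWord ht] at hleaves
  rw [AndOrTree.UsesFirst, hleaves]
  simp [boundedWords, List.mem_ofFn]

theorem equiv_iff {n : ℕ} {A B : AndOrTree} (hA : A.size = n) (hB : B.size = n) :
    AndOrTree.equivalence.r A B ↔
      A.shape = B.shape ∧ SameCoincidences (treeWord n A) (treeWord n B) := by
  refine and_congr_right fun _ => ?_
  simp only [getElem?_leaves hA, getElem?_leaves hB]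
  constructor
  · rintro ⟨h1, h2⟩
    refine ⟨fun i j => ?_, fun i j => ?_⟩
    · simpa using h1 i j
    · simpa using h2 i j
  · rintro ⟨h1, h2⟩
    refine ⟨fun i j => ?_, fun i j => ?_⟩
    · by_cases hi : i < n <;> by_cases hj : j < n <;> simp [hi, hj, h1]
    · by_cases hi : i < n <;> by_cases hj : j < n <;> simp [hi, hj, h2]

theorem finite_trees (n k : ℕ) : (CatalanModel.trees n k).Finite := by
  refine ((finite_family treeStructures n).image2 labelledTree
    (finite_boundedWords (Fin n) k)).subset ?_
  rintro t ⟨ht, hk⟩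
  exact ⟨t.shape, ⟨trivial, (BTree.size_shape t).trans ht⟩, treeWord n t,
    (usesFirst_iff ht k).1 hk, labelledTree_treeWord ht⟩

/-- The tree-structure of an and/or tree of size `n` and the class of its labelling. -/
def treeCode (m : CatalanModel) (n : ℕ) (t : AndOrTree) :
    TreeStructure × Quotient (wordSetoid m (Fin n)) :=
  (t.shape, wordClass m (treeWord n t))

/-- In both models, what is counted are pairs of a tree-structure and a class of labellings. -/
theorem count_eq_ncard_treeCode (m : CatalanModel) {n k : ℕ} {S : Set AndOrTree}
    (hS : S ⊆ CatalanModel.trees n k) : m.count S = (treeCode m n '' S).ncard := by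
  have hfin : S.Finite := (finite_trees n k).subset hS
  cases m with
  | G =>
    refine (Set.InjOn.ncard_image fun t ht t' ht' h => ?_).symm
    rw [treeCode, treeCode, Prod.mk.injEq, wordClass_G_eq_iff] at h
    rw [← labelledTree_treeWord (hS ht).1, ← labelledTree_treeWord (hS ht').1, h.1, h.2]
  | E =>
    have h : ∀ t ∈ S, ∀ t' ∈ S,
        ((⟦t⟧ : Quotient AndOrTree.equivalence) = ⟦t'⟧ ↔ treeCode .E n t = treeCode .E n t') := by
      intro t ht t' ht'
      rw [treeCode, treeCode, Prod.mk.injEq, wordClass_E_eq_iff, Quotient.eq]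
      exact equiv_iff (hS ht).1 (hS ht').1
    exact le_antisymm
      (ncard_image_le_of_factor (hfin.image _) (fun t ht => Set.mem_image_of_mem _ ht)
        fun t ht t' ht' => (h t ht t' ht').2)
      (ncard_image_le_of_factor (hfin.image _) (fun t ht => Set.mem_image_of_mem _ ht)
        fun t ht t' ht' => (h t ht t' ht').1)

/-- The choices of a tree-structure and of a class of labellings are independent. -/
theorem total_eq (m : CatalanModel) (n k : ℕ) :
    m.total n k = familyCount treeStructures n * wordCount m n k := by
  rw [CatalanModel.total, count_eq_ncard_treeCode m subset_rfl, familyCount, wordCount,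
    ← Set.ncard_prod]
  congr 1
  ext ⟨σ, x⟩
  constructor
  · rintro ⟨t, ⟨ht, hk⟩, h⟩
    obtain ⟨rfl, rfl⟩ := Prod.mk.inj h
    exact ⟨⟨trivial, (BTree.size_shape t).trans ht⟩, _, (usesFirst_iff ht k).1 hk, rfl⟩
  · rintro ⟨⟨-, hσ⟩, w, hw, rfl⟩
    have hsize := size_labelledTree hσ w
    refine ⟨labelledTree σ w, ⟨hsize, (usesFirst_iff hsize k).2 ?_⟩, ?_⟩
    · rwa [treeWord_labelledTree hσ]
    · rw [treeCode, shape_labelledTree, treeWord_labelledTree hσ]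

/-! ### Repetitions -/

namespace Pattern

theorem patternLeaves_map {α β : Type} (f : α → β) (q : Pattern) (t : BTree α) :
    patternLeaves q (t.map f) = (patternLeaves q t).map f := by
  induction q generalizing t with
  | leaf a => cases a <;> cases t <;> rfl
  | node c p q hp hq =>
    cases t with
    | leaf a => rfl
    | node c' l r => simp [BTree.map, patternLeaves, hp, hq]

theorem patternLeaves_sublist {α : Type} (q : Pattern) (t : BTree α) :
    (patternLeaves q t).Sublist t.leaves := by
  induction q generalizing t with
  | leaf a => cases a <;> cases t <;> simp [patternLeaves, BTree.leaves]
  | node c p q hp hq =>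
    cases t with
    | leaf a => simp [patternLeaves]
    | node c' l r => exact (hp l).append (hq r)

theorem length_patternLeaves_le {α : Type} (q : Pattern) (t : BTree α) :
    (patternLeaves q t).length ≤ bullets q := by
  induction q generalizing t with
  | leaf a => cases a <;> cases t <;> simp [patternLeaves, bullets]
  | node c p q hp hq =>
    cases t with
    | leaf a => simp [patternLeaves]
    | node c' l r =>
      rw [patternLeaves, bullets, List.length_append]
      exact Nat.add_le_add (hp l) (hq r)

/-- The positions of the pattern leaves in a tree-structure of size `n` built from a pattern. -/
def positions (q : Pattern) (σ : TreeStructure) (n : ℕ) : Finset (Fin n) :=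
  Finset.univ.filter fun i => (i : ℕ) ∈ patternLeaves q (σ.index 0)

theorem image_val_positions (q : Pattern) {σ : TreeStructure} {n : ℕ} (hσ : σ.size = n) :
    (positions q σ n).image Fin.val = (patternLeaves q (σ.index 0)).toFinset := by
  ext i
  simp only [positions, Finset.mem_image, Finset.mem_filter, Finset.mem_univ, true_and,
    List.mem_toFinset]
  constructor
  · rintro ⟨j, hj, rfl⟩; exact hj
  · intro hi
    have := (patternLeaves_sublist q (σ.index 0)).subset hi
    rw [BTree.leaves_index, hσ, List.mem_range'_1] at this
    exact ⟨⟨i, by omega⟩, hi, rfl⟩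

theorem card_positions (q : Pattern) {σ : TreeStructure} {n : ℕ} (hσ : σ.size = n) :
    (positions q σ n).card = (patternLeaves q (σ.index 0)).length := by
  rw [← Finset.card_image_of_injective _ Fin.val_injective, image_val_positions q hσ,
    List.toFinset_card_of_nodup]
  refine (patternLeaves_sublist q (σ.index 0)).nodup ?_
  rw [BTree.leaves_index]
  exact List.nodup_range'

theorem repetitions_eq (q : Pattern) {t : AndOrTree} {n : ℕ} (ht : t.size = n) :
    repetitions q t = (positions q t.shape n).card -
      ((positions q t.shape n).image fun i => (treeWord n t i).var).card := by
  have hσ : t.shape.size = n := (BTree.size_shape t).trans ht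
  have hleaves : patternLeaves q t =
      (patternLeaves q (t.shape.index 0)).map fun i => t.leaves.getD i ⟨0, true⟩ := by
    conv_lhs => rw [eq_map_index t]
    rw [patternLeaves_map]
  have himage : ((patternLeaves q t).map Literal.var).toFinset =
      (positions q t.shape n).image fun i => (treeWord n t i).var := by
    have : (fun i : Fin n => (treeWord n t i).var) =
        (fun i : ℕ => (t.leaves.getD i ⟨0, true⟩).var) ∘ Fin.val := rfl
    rw [this, ← Finset.image_image, image_val_positions q hσ, hleaves]
    ext v
    simp
  rw [repetitions, himage, hleaves, List.length_map, card_positions q hσ]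

end Pattern

/-! ### The union bound over patterns -/

/-- Union bound over the patterns of the language and the trees built from them. -/
theorem atLeast_le (m : CatalanModel) (L : PatternLanguage) {r : ℕ} (hr : 0 < r) (n k : ℕ) :
    m.atLeast L r n k ≤ ∑ q ∈ patternsLE L n, familyCount
      {t | Pattern.PlugsInto treeStructures q t} n *
        ((2 * Pattern.bullets q ^ 2) ^ r * wordCount m (n - r) k) := by
  rw [CatalanModel.atLeast, count_eq_ncard_treeCode m (n := n) (k := k) fun t ht => ht.1]
  let Sh : Pattern → Set TreeStructure := fun q =>
    {σ | σ ∈ {t | Pattern.PlugsInto treeStructures q t} ∧ σ.size = n}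
  let W : Pattern → TreeStructure → Set (Quotient (wordSetoid m (Fin n))) := fun q σ =>
    wordClass m '' {w | w ∈ boundedWords (Fin n) k ∧
      r + ((Pattern.positions q σ n).image fun i => (w i).var).card ≤
        (Pattern.positions q σ n).card}
  have hSh : ∀ q, (Sh q).Finite := fun q => finite_family _ n
  have hW : ∀ q σ, (W q σ).Finite := fun q σ =>
    ((finite_boundedWords _ k).subset fun w hw => hw.1).image _
  let U : Pattern → Set (TreeStructure × Quotient (wordSetoid m (Fin n))) := fun q =>
    ⋃ σ ∈ (hSh q).toFinset, ({σ} : Set TreeStructure) ×ˢ W q σ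
  have hU : ∀ q, (U q).Finite := fun q =>
    (Finset.finite_toSet _).biUnion fun σ _ => (Set.finite_singleton σ).prod (hW q σ)
  have hsub : treeCode m n '' {t | t ∈ CatalanModel.trees n k ∧
      ∃ s, r ≤ s ∧ L.HasRepetitions t s} ⊆ ⋃ q ∈ patternsLE L n, U q := by
    rintro _ ⟨t, ⟨⟨ht, hk⟩, s, hrs, q, hq, hplug, rfl⟩, rfl⟩
    have hσ : t.shape.size = n := (BTree.size_shape t).trans ht
    refine Set.mem_biUnion (x := q) (mem_patternsLE.2 ⟨hq, hplug.size_le.trans hσ.le⟩) ?_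
    refine Set.mem_biUnion (x := t.shape) ?_
      ⟨rfl, treeWord n t, ⟨(usesFirst_iff ht k).1 hk, ?_⟩, rfl⟩
    · exact (hSh q).mem_toFinset.2 ⟨hplug, hσ⟩
    -- As `0 < r`, the truncated subtraction in the number of repetitions is a genuine one.
    · rw [Pattern.repetitions_eq q ht] at hrs
      omega
  have hUcard : ∀ q, (U q).ncard ≤ familyCount {t | Pattern.PlugsInto treeStructures q t} n *
      ((2 * Pattern.bullets q ^ 2) ^ r * wordCount m (n - r) k) := by
    intro q
    have hterm : ∀ σ ∈ (hSh q).toFinset, (({σ} : Set TreeStructure) ×ˢ W q σ).ncard ≤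
        (2 * Pattern.bullets q ^ 2) ^ r * wordCount m (n - r) k := by
      intro σ hσ
      have hσ' : σ ∈ Sh q := by simpa using hσ
      have h := ncard_wordClass_repetitions_le m k r (Fin n) (Pattern.positions q σ n)
      rw [Fintype.card_fin] at h
      rw [Set.ncard_prod, Set.ncard_singleton, one_mul]
      refine h.trans ?_
      have : (Pattern.positions q σ n).card ≤ Pattern.bullets q := by
        rw [Pattern.card_positions q hσ'.2]
        exact Pattern.length_patternLeaves_le _ _
      gcongr
    refine (Finset.set_ncard_biUnion_le _ _).trans ((Finset.sum_le_card_nsmul _ _ _ hterm).trans ?_)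
    rw [smul_eq_mul, ← Set.ncard_eq_toFinset_card _ (hSh q)]
    rfl
  exact (Set.ncard_le_ncard hsub ((Finset.finite_toSet _).biUnion fun q _ => hU q)).trans
    ((Finset.set_ncard_biUnion_le _ _).trans (Finset.sum_le_sum fun q _ => hUcard q))

theorem exactly_le_atLeast (m : CatalanModel) (L : PatternLanguage) (r n k : ℕ) :
    m.exactly L r n k ≤ m.atLeast L r n k := by
  rw [CatalanModel.exactly, CatalanModel.atLeast,
    count_eq_ncard_treeCode m (n := n) (k := k) fun t ht => ht.1,
    count_eq_ncard_treeCode m (n := n) (k := k) fun t ht => ht.1]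
  exact Set.ncard_le_ncard (Set.image_mono fun t ht => ⟨ht.1, r, le_rfl, ht.2⟩)
    (((finite_trees n k).subset fun t ht => ht.1).image _)

/-- The estimate is uniform in the number `k` of variables. -/
theorem exists_atLeast_div_total_le {L : PatternLanguage} (hsub : L.Subcritical treeStructures)
    {r : ℕ} (hr : 0 < r) (m : CatalanModel) : ∃ K : ℝ, ∀ n k : ℕ, r < n → 0 < k →
      (m.atLeast L r n k : ℝ) / m.total n k ≤ K * m.rat n k ^ r := by
  obtain ⟨K, hK⟩ := exists_sum_weighted_familyCount_le hsub r
  refine ⟨K * (5 / 2) ^ (r ^ 2), fun n k hn hk => ?_⟩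
  obtain ⟨n, rfl⟩ := Nat.exists_eq_add_of_le' hn.le
  have hn0 : 0 < n := by omega
  have hnr : 0 < n + r := by omega
  have hT : (0 : ℝ) < familyCount treeStructures (n + r) := by
    exact_mod_cast familyCount_pos hnr
  have hlab := m.lab_pos hnr hk
  have hlab' := m.lab_pos hn0 hk
  have hK0 : 0 ≤ K := by
    have h := hK (n + r) hnr
    have h0 : 0 ≤ K * familyCount treeStructures (n + r) :=
      le_trans (Finset.sum_nonneg fun q _ => by positivity) h
    exact nonneg_of_mul_nonneg_left h0 hT
  have hle : (m.atLeast L r (n + r) k : ℝ) ≤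
      (K * familyCount treeStructures (n + r)) * m.lab n k := by
    refine (Nat.cast_le.2 (atLeast_le m L hr (n + r) k)).trans ?_
    rw [Nat.add_sub_cancel]
    push_cast
    rw [wordCount_eq_lab m hn0]
    calc _ = (∑ q ∈ patternsLE L (n + r), (2 * (Pattern.bullets q : ℝ) ^ 2) ^ r *
          (familyCount {t | Pattern.PlugsInto treeStructures q t} (n + r) : ℝ)) * m.lab n k := by
          rw [Finset.sum_mul]
          exact Finset.sum_congr rfl fun q _ => by ring
      _ ≤ _ := mul_le_mul_of_nonneg_right (hK _ hnr) hlab'.le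
  have htotal : (m.total (n + r) k : ℝ) =
      familyCount treeStructures (n + r) * m.lab (n + r) k := by
    rw [total_eq, Nat.cast_mul, wordCount_eq_lab m hnr]
  rw [htotal]
  calc _ ≤ (K * familyCount treeStructures (n + r)) * m.lab n k /
        (familyCount treeStructures (n + r) * m.lab (n + r) k) := by gcongr
    _ = K * (m.lab n k / m.lab (n + r) k) := by field_simp
    _ ≤ K * ((5 / 2) ^ (r ^ 2) * m.rat (n + r) k ^ r) :=
      mul_le_mul_of_nonneg_left (m.lab_div_lab_le r hn0 hk) hK0
    _ = _ := by ring

theorem mainTheorem6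
    (L : PatternLanguage) (hL : L.Unambiguous) (hsub : L.Subcritical treeStructures)
    (k : ℕ → ℕ) (hmono : MonotoneOn k (Set.Ici 1)) (hk : Tendsto k atTop atTop)
    (r : ℕ) (hr : 0 < r) (m : CatalanModel) :
    ((fun n : ℕ => (m.exactly L r n (k n) : ℝ) / (m.total n (k n) : ℝ))
        =O[atTop] fun n : ℕ => m.rat n (k n) ^ r) ∧
    ((fun n : ℕ => (m.atLeast L r n (k n) : ℝ) / (m.total n (k n) : ℝ))
        =O[atTop] fun n : ℕ => m.rat n (k n) ^ r) := by
  obtain ⟨K, hK⟩ := exists_atLeast_div_total_le hsub hr m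
  have hbound : ∀ᶠ n in atTop, (m.atLeast L r n (k n) : ℝ) / (m.total n (k n) : ℝ) ≤
      K * ‖m.rat n (k n) ^ r‖ := by
    filter_upwards [eventually_gt_atTop (r + 1), hk.eventually_gt_atTop 0] with n hn hkn
    have hpos : 0 < m.rat n (k n) :=
      div_pos (m.lab_pos (by omega) hkn) (m.lab_pos (by omega) hkn)
    rw [Real.norm_of_nonneg (by positivity)]
    exact hK n (k n) (by omega) hkn
  refine ⟨IsBigO.of_bound K ?_, IsBigO.of_bound K ?_⟩
  · filter_upwards [hbound] with n hn
    rw [Real.norm_of_nonneg (by positivity)]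
    refine le_trans ?_ hn
    gcongr
    exact exactly_le_atLeast m L r n (k n)
  · filter_upwards [hbound] with n hn
    rw [Real.norm_of_nonneg (by positivity)]
    exact hn
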